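/- Let $B_2$ be the open unit ball of $\mathbb C^2$, let $K(z,w)$ be its Bergman kernel (the reproducing kernel of the space $A^2(B_2)$ of square-integrable holomorphic functions with respect to Lebesgue measure), and let $\pi(z_1,z_2)=(z_1^2,z_2)$. Then $\pi:B_2\setminus\{z_1=0\}\to\pi(B_2)\setminus\{\zeta_1=0\}$ defines a normal ramified covering of the bounded domain $\pi(B_2)$ by $B_2$ (that is, it is a finite-sheeted holomorphic covering map between complements of proper analytic subsets whose covering group acts transitively on the fibers), with covering group $G=\{\mathrm{id},r\}$, where $r(z_1,z_2)=(-z_1,z_2)$. Put \[ K_G(z,w)=\frac1{|G|}\sum_{g\in G}K(z,g.w)\,\overline{\det g}=\tfrac12\big(K(z,w)-K(z,r.w)\big), \] let $J_G(z)=\prod_Y\langle z,e_Y\rangle^{m_Y-1}$ be the Jacobian polynomial of $G$, where $Y$ runs over the reflecting hyperplanes of $G$, $e_Y$ is any unit vector orthogonal to $Y$, and $m_Y$ is the number of elements of $G$ that fix $Y$ pointwise (so $|J_G(z)|=|z_1|$), and for $p\in(1,\infty)$ put \[ K_{G,p}(z,w)=|J_G(z)|^{\frac2p-1}\,K_G(z,w)\,|J_G(w)|^{1-\frac2p}.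 \] Then for every $p\in(1,\infty)$ the integral operator with positive kernel $|K_{G,p}|$ is bounded on $L^p(B_2)$: there is a finite constant $C$ such that for every $f\in L^p(B_2)$ the integral $Tf(z)=\int_{B_2}|K_{G,p}(z,w)|f(w)\,dw$ converges absolutely for almost every $z\in B_2$, and $\|Tf\|_{L^p(B_2)}\le C\|f\|_{L^p(B_2)}$. -/

import Mathlib

open MeasureTheory Set
open scoped ENNReal NNReal ComplexConjugate

namespace BergmanCovering

noncomputable section

/-- The space `ℂⁿ` with its standard Hermitian product, Euclidean norm and Lebesgue measure. -/
abbrev CSpace (n : ℕ) : Type := EuclideanSpace ℂ (Fin n)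

/-- The unitary group `U(n)`, acting on `ℂⁿ`. -/
abbrev UGroup (n : ℕ) : Type := CSpace n ≃ₗᵢ[ℂ] CSpace n

/-- A bounded domain: a nonempty, open, connected and bounded set. -/
structure IsBoundedDomain {n : ℕ} (E : Set (CSpace n)) : Prop where
  isOpen : IsOpen E
  isConnected : IsConnected E
  isBounded : Bornology.IsBounded E

/-! ### The Bergman kernel -/

/-- Membership in the Bergman space `A²(E) = L²(E) ∩ 𝒪(E)`. -/
structure MemBergman {n : ℕ} (E : Set (CSpace n)) (f : CSpace n → ℂ) : Prop where
  holomorphic : DifferentiableOn ℂ f E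
  memLp : MemLp f 2 (volume.restrict E)

/-- `K` is the Bergman kernel of `E`, i.e. the reproducing kernel of `A²(E)`: for every `z ∈ E` the
function `w ↦ conj (K(z, w))` belongs to `A²(E)` and `f(z) = ∫_E K(z, w) f(w) dw` for every
`f ∈ A²(E)`. These conditions determine `K` on `E × E`. -/
structure IsBergmanKernel {n : ℕ} (E : Set (CSpace n)) (K : CSpace n → CSpace n → ℂ) : Prop where
  memBergman : ∀ z ∈ E, MemBergman E (fun w => conj (K z w))
  reproducing : ∀ z ∈ E, ∀ f : CSpace n → ℂ, MemBergman E f → f z = ∫ w in E, K z w * f w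

open Classical in
/-- The Bergman kernel of `E`. Its values on `E × E` are the meaningful ones. -/
def bergmanKernel {n : ℕ} (E : Set (CSpace n)) : CSpace n → CSpace n → ℂ :=
  if h : ∃ K, IsBergmanKernel E K then h.choose else 0

/-! ### Ramified coverings -/

/-- `V` is a complex analytic subset of the open set `E`: near every point of `E` it is the common
zero set of finitely many holomorphic functions. -/
def IsAnalyticSubset {n : ℕ} (E V : Set (CSpace n)) : Prop :=
  V ⊆ E ∧ ∀ z ∈ E, ∃ U : Set (CSpace n), IsOpen U ∧ z ∈ U ∧ U ⊆ E ∧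
    ∃ (m : ℕ) (F : Fin m → CSpace n → ℂ), (∀ i, DifferentiableOn ℂ (F i) U) ∧
      V ∩ U = {x ∈ U | ∀ i, F i x = 0}

/-- `π : E ⇢ D` is a ramified covering: `E` and `D` are bounded domains, `V ⊊ E` and `W ⊊ D` are
proper analytic subsets, and `π : E \ V → D \ W` is a finite-sheeted holomorphic covering map. -/
structure IsRamifiedCovering {n : ℕ} (E D V W : Set (CSpace n)) (π : CSpace n → CSpace n) :
    Prop where
  source : IsBoundedDomain E
  target : IsBoundedDomain D
  analytic_source : IsAnalyticSubset E V
  proper_source : V ≠ E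
  analytic_target : IsAnalyticSubset D W
  proper_target : W ≠ D
  holomorphic : DifferentiableOn ℂ π (E \ V)
  surjOn : SurjOn π (E \ V) (D \ W)
  finite_fibers : ∀ ζ ∈ D \ W, {z ∈ E \ V | π z = ζ}.Finite
  covering : ∃ h : MapsTo π (E \ V) (D \ W), IsCoveringMap (h.restrict π (E \ V) (D \ W))

/-- The covering group of `π : E \ V → D \ W`: all automorphisms `g` of `E \ V` with `π ∘ g = π`. -/
def coveringGroup {n : ℕ} (E V : Set (CSpace n)) (π : CSpace n → CSpace n) :
    Subgroup ((E \ V : Set (CSpace n)) ≃ₜ (E \ V : Set (CSpace n))) where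
  carrier := {g | ∀ z, π (g z) = π z}
  mul_mem' := by
    intro a b ha hb z
    exact (ha (b z)).trans (hb z)
  one_mem' := fun _ => rfl
  inv_mem' := by
    intro a ha z
    have h := ha (a⁻¹ z)
    rw [← h]
    exact congrArg (fun x : (E \ V : Set (CSpace n)) => π x) (a.apply_symm_apply z)

/-- A ramified covering is normal if its covering group acts transitively on the fibers. -/
structure IsNormalRamifiedCovering {n : ℕ} (E D V W : Set (CSpace n)) (π : CSpace n → CSpace n) :
    Prop extends IsRamifiedCovering E D V W π where
  transitive : ∀ z₁ z₂ : (E \ V : Set (CSpace n)),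
    π z₁ = π z₂ ↔ ∃ g ∈ coveringGroup E V π, g z₁ = z₂

/-- The covering group consists exactly of the restrictions to `E \ V` of the elements of the
group `G` of unitary transformations. -/
def CoveringGroupIs {n : ℕ} (E V : Set (CSpace n)) (π : CSpace n → CSpace n)
    (G : Subgroup (UGroup n)) : Prop :=
  (∀ g ∈ coveringGroup E V π, ∃ h ∈ G, ∀ z, (g z : CSpace n) = h z) ∧
    ∀ h ∈ G, ∃ g ∈ coveringGroup E V π, ∀ z, (g z : CSpace n) = h z

/-! ### Unitary reflection groups and their Jacobian polynomials -/

/-- The subspace of vectors fixed by `g`. -/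
def fixedSubspace {n : ℕ} (g : UGroup n) : Submodule ℂ (CSpace n) where
  carrier := {v | g v = v}
  add_mem' := by
    intro a b ha hb
    change g (a + b) = a + b
    rw [map_add, show g a = a from ha, show g b = b from hb]
  zero_mem' := map_zero g
  smul_mem' := by
    intro c a ha
    change g (c • a) = c • a
    rw [map_smul, show g a = a from ha]

/-- A unitary reflection: an element of `U(n)` of finite order whose fixed space is a hyperplane. -/
def IsReflection {n : ℕ} (g : UGroup n) : Prop :=
  IsOfFinOrder g ∧ Module.finrank ℂ (fixedSubspace g) + 1 = n

/-- The set `ℛ_G` of reflecting hyperplanes of `G`. -/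
def reflectingHyperplanes {n : ℕ} (G : Subgroup (UGroup n)) : Set (Submodule ℂ (CSpace n)) :=
  {Y | ∃ g ∈ G, IsReflection g ∧ fixedSubspace g = Y}

/-- The multiplicity `m_Y`: the order of the group of the elements of `G` fixing `Y` pointwise. -/
def hyperplaneOrder {n : ℕ} (G : Subgroup (UGroup n)) (Y : Submodule ℂ (CSpace n)) : ℕ :=
  Nat.card {g : UGroup n // g ∈ G ∧ ∀ v ∈ Y, g v = v}

/-- `e` chooses a root `e_Y`, i.e. a unit vector orthogonal to `Y`, for every `Y ∈ ℛ_G`. -/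
def IsRootChoice {n : ℕ} (G : Subgroup (UGroup n)) (e : Submodule ℂ (CSpace n) → CSpace n) : Prop :=
  ∀ Y ∈ reflectingHyperplanes G, ‖e Y‖ = 1 ∧ ∀ v ∈ Y, inner ℂ (e Y) v = 0

/-- The Jacobian polynomial `J_G(z) = ∏_{Y ∈ ℛ_G} ⟨z, e_Y⟩ ^ (m_Y - 1)`. (Mathlib's inner product is
linear in the second variable.) -/
def jacobianPolynomial {n : ℕ} (G : Subgroup (UGroup n)) (e : Submodule ℂ (CSpace n) → CSpace n)
    (z : CSpace n) : ℂ :=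
  ∏ᶠ Y ∈ reflectingHyperplanes G, (inner ℂ (e Y) z) ^ (hyperplaneOrder G Y - 1)

/-! ### Averaged kernels -/

/-- The complex Jacobian determinant of a linear transformation `g ∈ U(n)`. -/
def jacobianDet {n : ℕ} (g : UGroup n) : ℂ :=
  LinearMap.det (g.toLinearEquiv : CSpace n →ₗ[ℂ] CSpace n)

/-- The averaged kernel `K_G(z, w) = |G|⁻¹ ∑_{g ∈ G} K(z, g.w) conj (J(g))` of a finite group `G`,
where `K` is the Bergman kernel of `E`. -/
def averagedKernel {n : ℕ} (E : Set (CSpace n)) (G : Subgroup (UGroup n)) (z w : CSpace n) : ℂ :=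
  (Nat.card G : ℂ)⁻¹ *
    ∑ᶠ g : G, bergmanKernel E z ((g : UGroup n) w) * conj (jacobianDet (g : UGroup n))

/-- The kernel `K_{G,p}(z, w) = |J_G(z)|^{2/p - 1} K_G(z, w) |J_G(w)|^{1 - 2/p}`. -/
def weightedKernel {n : ℕ} (E : Set (CSpace n)) (G : Subgroup (UGroup n))
    (e : Submodule ℂ (CSpace n) → CSpace n) (p : ℝ) (z w : CSpace n) : ℂ :=
  ((‖jacobianPolynomial G e z‖ ^ (2 / p - 1) : ℝ) : ℂ) * averagedKernel E G z w *
    ((‖jacobianPolynomial G e w‖ ^ (1 - 2 / p) : ℝ) : ℂ)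

/-- The integral operator `f ↦ ∫_E k(·, w) f(w) dw` is bounded on `L^p(E)`: for every `f ∈ L^p(E)`
the integral converges absolutely for almost every `z ∈ E` and defines an `L^p` function of norm at
most `C ‖f‖_p`, with `C` independent of `f`. -/
def IsLpBoundedOperator {n : ℕ} (E : Set (CSpace n)) (k : CSpace n → CSpace n → ℝ) (p : ℝ≥0∞) :
    Prop :=
  ∃ C : ℝ≥0, ∀ f : CSpace n → ℂ, MemLp f p (volume.restrict E) →
    (∀ᵐ z ∂(volume.restrict E), IntegrableOn (fun w => (k z w : ℂ) * f w) E) ∧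
    MemLp (fun z => ∫ w in E, (k z w : ℂ) * f w) p (volume.restrict E) ∧
    eLpNorm (fun z => ∫ w in E, (k z w : ℂ) * f w) p (volume.restrict E) ≤
      C * eLpNorm f p (volume.restrict E)

/-! ### The covering `(z₁, z₂) ↦ (z₁², z₂)` of the unit ball of `ℂ²` -/

/-- The unit ball `B₂` of `ℂ²`. -/
def ball2 : Set (CSpace 2) := Metric.ball 0 1

/-- The map `π(z₁, z₂) = (z₁², z₂)`. -/
def squareMap (z : CSpace 2) : CSpace 2 := !₂[z 0 ^ 2, z 1]

/-- The reflection `r(z₁, z₂) = (-z₁, z₂)`. -/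
def reflection2 : UGroup 2 where
  toFun z := !₂[-z 0, z 1]
  invFun z := !₂[-z 0, z 1]
  map_add' x y := by ext i; fin_cases i <;> simp [add_comm]
  map_smul' c x := by ext i; fin_cases i <;> simp
  left_inv x := by ext i; fin_cases i <;> simp
  right_inv x := by ext i; fin_cases i <;> simp
  norm_map' x := by
    change ‖(!₂[-x 0, x 1] : CSpace 2)‖ = ‖x‖
    simp [EuclideanSpace.norm_eq, Fin.sum_univ_two]

theorem reflection2_mul_self : reflection2 * reflection2 = 1 :=
  LinearIsometryEquiv.ext fun x => reflection2.left_inv x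

/-- The group `G = {id, r}`. -/
def group2 : Subgroup (UGroup 2) where
  carrier := {1, reflection2}
  mul_mem' := by
    rintro a b (rfl | rfl) (rfl | rfl) <;> simp [reflection2_mul_self]
  one_mem' := by simp
  inv_mem' := by
    rintro a (rfl | rfl)
    · simp
    · rw [inv_eq_of_mul_eq_one_left reflection2_mul_self]
      simp

end

end BergmanCovering

open BergmanCovering

/-! Why the bound holds. The Bergman kernel of the ball is (2/π²)(1 - ⟨z, w⟩)⁻³. Put X = 1 - ⟨z, w⟩
and Y = 1 - ⟨z, r.w⟩, so that K_G is π⁻²(X⁻³ - Y⁻³). For p ≠ 2 the weight (|w₁|/|z₁|)^s, s = 1 -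
2/p, is unbounded near the mirror z₁ = 0 or w₁ = 0, and only the cancellation in this difference
controls it. Since Y - X = 2z₁w̄₁ and X + Y = 2(1 - z₂w̄₂), factoring the difference of cubes gives
|X⁻³ - Y⁻³| |1 - z₂w̄₂| ≤ 3 |z₁| |w₁| (|X|⁻³ + |Y|⁻³). In the ball |z₁|² and |w₁|² are at most 2|1 -
z₂w̄₂|, so the difference times either |w₁|/|z₁| or its inverse is at most 6(|X|⁻³ + |Y|⁻³). As |s|
≤ 1 for p > 1, the power with exponent s is controlled by these two extremes
(`weight_mul_norm_sub_le`).

The weighted kernel is thus dominated by the positive Bergman kernel and its reflected copy, which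
are bounded on every L^p with 1 < p < ∞: Schur's test (`lintegral_rpow_le_of_schur`) with a power of
1 - |z|², fed by the Forelli–Rudin estimate `exists_lintegral_ballWeight_le`.

The closed form of the kernel (`isBergmanKernel_ballKernel`) is checked directly: a unitary map
moves z to the first axis, the mean value property integrates out w₂, and Cauchy's formula settles
the remaining weighted integral over the disc. The covering group is found by uniqueness of lifts,
the ball minus the mirror being connected. -/

/-! ### The ramified covering -/

/-- The coordinates of `ℂ²`, as a linear isometry from the Hilbert sum `ℂ ⊕ ℂ`. -/
noncomputable def pairIsometry : WithLp 2 (ℂ × ℂ) ≃ₗᵢ[ℝ] CSpace 2 where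
  toFun p := !₂[p.fst, p.snd]
  invFun z := WithLp.toLp 2 (z 0, z 1)
  map_add' x y := by ext i; fin_cases i <;> simp
  map_smul' c x := by ext i; fin_cases i <;> simp
  left_inv x := rfl
  right_inv x := by ext i; fin_cases i <;> simp
  norm_map' x := by
    change ‖(!₂[x.fst, x.snd] : CSpace 2)‖ = ‖x‖
    simp [EuclideanSpace.norm_eq, Fin.sum_univ_two, WithLp.prod_norm_eq_of_L2]

/-- The identification of `ℂ × ℂ` with `ℂ²`. -/
noncomputable def pairHomeo : ℂ × ℂ ≃ₜ CSpace 2 where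
  toFun p := !₂[p.1, p.2]
  invFun z := (z 0, z 1)
  left_inv x := rfl
  right_inv x := by ext i; fin_cases i <;> simp
  continuous_toFun := by fun_prop
  continuous_invFun := by fun_prop

@[simp] theorem pairHomeo_apply_zero (p : ℂ × ℂ) : pairHomeo p 0 = p.1 := rfl

@[simp] theorem pairHomeo_apply_one (p : ℂ × ℂ) : pairHomeo p 1 = p.2 := rfl

theorem pairHomeo_symm_apply (z : CSpace 2) : pairHomeo.symm z = (z 0, z 1) := rfl

theorem measurePreserving_pairHomeo : MeasurePreserving pairHomeo :=
  pairIsometry.measurePreserving.comp (WithLp.volume_preserving_toLp ℂ ℂ)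

theorem norm_sq_cspace_two (z : CSpace 2) : ‖z‖ ^ 2 = ‖z 0‖ ^ 2 + ‖z 1‖ ^ 2 := by
  simp [EuclideanSpace.norm_sq_eq, Fin.sum_univ_two]

theorem mem_ball2 {z : CSpace 2} : z ∈ ball2 ↔ ‖z 0‖ ^ 2 + ‖z 1‖ ^ 2 < 1 := by
  rw [← norm_sq_cspace_two, ball2, mem_ball_zero_iff, sq_lt_one_iff₀ (norm_nonneg z)]

@[simp] theorem squareMap_apply_zero (z : CSpace 2) : squareMap z 0 = z 0 ^ 2 := rfl

@[simp] theorem squareMap_apply_one (z : CSpace 2) : squareMap z 1 = z 1 := rfl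

@[simp] theorem reflection2_apply_zero (z : CSpace 2) : reflection2 z 0 = -z 0 := rfl

@[simp] theorem reflection2_apply_one (z : CSpace 2) : reflection2 z 1 = z 1 := rfl

theorem cspace_two_ext {z w : CSpace 2} (h₀ : z 0 = w 0) (h₁ : z 1 = w 1) : z = w := by
  ext i; fin_cases i <;> assumption

theorem squareMap_eq_iff {z w : CSpace 2} :
    squareMap z = squareMap w ↔ w = z ∨ w = reflection2 z := by
  constructor
  · intro h
    have h0 : w 0 ^ 2 = z 0 ^ 2 := (congrArg (fun x : CSpace 2 => x 0) h).symm
    have h1 : w 1 = z 1 := (congrArg (fun x : CSpace 2 => x 1) h).symm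
    rcases sq_eq_sq_iff_eq_or_eq_neg.mp h0 with h | h
    · exact .inl (cspace_two_ext h h1)
    · exact .inr (cspace_two_ext h h1)
  · rintro (rfl | rfl)
    · rfl
    · exact cspace_two_ext (by simp) rfl

theorem image_squareMap_ball2 :
    squareMap '' ball2 = {ζ : CSpace 2 | ‖ζ 0‖ + ‖ζ 1‖ ^ 2 < 1} := by
  ext ζ
  constructor
  · rintro ⟨z, hz, rfl⟩
    simpa using mem_ball2.mp hz
  · intro hζ
    obtain ⟨u, hu⟩ := IsAlgClosed.exists_pow_nat_eq (ζ 0) two_pos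
    refine ⟨!₂[u, ζ 1], mem_ball2.mpr ?_, cspace_two_ext ?_ rfl⟩
    · have : ‖ζ 0‖ = ‖u‖ ^ 2 := by rw [← hu, norm_pow]
      simpa [← this] using hζ
    · simp [hu]

theorem preimage_squareMap_compl :
    squareMap ⁻¹' (squareMap '' ball2 \ {ζ ∈ squareMap '' ball2 | ζ 0 = 0}) =
      ball2 \ {z ∈ ball2 | z 0 = 0} := by
  rw [image_squareMap_ball2]
  ext z
  simp [mem_ball2]

theorem continuous_squareMap : Continuous squareMap := by
  unfold squareMap; fun_prop

theorem isProperMap_sq : IsProperMap (fun z : ℂ => z ^ 2) := by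
  refine isProperMap_iff_tendsto_cocompact.mpr ⟨by fun_prop, ?_⟩
  rw [← Metric.cobounded_eq_cocompact, ← tendsto_norm_atTop_iff_cobounded]
  simp only [norm_pow]
  exact (Filter.tendsto_pow_atTop two_ne_zero).comp tendsto_norm_cobounded_atTop

theorem isProperMap_squareMap : IsProperMap squareMap :=
  pairHomeo.isProperMap.comp
    ((isProperMap_sq.prodMap (Homeomorph.refl ℂ).isProperMap).comp pairHomeo.symm.isProperMap)

theorem isLocalHomeomorphOn_squareMap :
    IsLocalHomeomorphOn squareMap (squareMap ⁻¹' {ζ | ζ 0 ≠ 0}) := by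
  intro z hz
  have hz' : z 0 ∈ (fun x : ℂ => x ^ 2) ⁻¹' {0}ᶜ := hz
  obtain ⟨φ, hφ, h⟩ := (isCoveringMapOn_npow (𝕜 := ℂ) 2 two_ne_zero).isLocalHomeomorphOn _ hz'
  refine ⟨(pairHomeo.symm.toOpenPartialHomeomorph.trans
    (φ.prod (OpenPartialHomeomorph.refl ℂ))).trans pairHomeo.toOpenPartialHomeomorph, ?_, ?_⟩
  · simpa [pairHomeo_symm_apply] using hφ
  · funext x
    refine cspace_two_ext ?_ rfl
    exact congrFun h (x 0)

theorem finite_fiber_squareMap (ζ : CSpace 2) : (squareMap ⁻¹' {ζ}).Finite := by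
  rcases (squareMap ⁻¹' {ζ}).eq_empty_or_nonempty with h | ⟨z, rfl⟩
  · simp [h]
  · refine (toFinite {z, reflection2 z}).subset fun w hw => ?_
    exact squareMap_eq_iff.mp hw.symm

/-- A closed map with finite fibres covers any set over which it is a local homeomorphism;
closedness follows from properness of squaring. -/
theorem isCoveringMapOn_squareMap : IsCoveringMapOn squareMap {ζ | ζ 0 ≠ 0} :=
  isProperMap_squareMap.isClosedMap.isCoveringMapOn_of_isLocalHomeomorphOn
    (fun _ _ => finite_fiber_squareMap _) isLocalHomeomorphOn_squareMap

theorem IsCoveringMapOn.isCoveringMap_restrict {X Y : Type*} [TopologicalSpace X]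
    [TopologicalSpace Y] {f : X → Y} {s : Set X} {t : Set Y} (h : IsCoveringMapOn f t)
    (hst : f ⁻¹' t = s) (hm : MapsTo f s t) : IsCoveringMap (hm.restrict f s t) := by
  subst hst
  exact h.isCoveringMap_restrictPreimage

theorem isBoundedDomain_ball2 : IsBoundedDomain ball2 where
  isOpen := Metric.isOpen_ball
  isConnected := Metric.isConnected_ball one_pos
  isBounded := Metric.isBounded_ball

theorem isBoundedDomain_image_squareMap : IsBoundedDomain (squareMap '' ball2) where
  isOpen := by
    rw [image_squareMap_ball2]
    exact isOpen_lt (by fun_prop) continuous_const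
  isConnected := isBoundedDomain_ball2.isConnected.image _ continuous_squareMap.continuousOn
  isBounded := by
    refine ((isCompact_closedBall (0 : CSpace 2) 1).image continuous_squareMap).isBounded.subset ?_
    exact image_mono Metric.ball_subset_closedBall

theorem isAnalyticSubset_sep_eq_zero {n : ℕ} {E : Set (CSpace n)} (hE : IsOpen E) (i : Fin n) :
    IsAnalyticSubset E {z ∈ E | z i = 0} := by
  refine ⟨sep_subset _ _, fun z hz => ⟨E, hE, hz, subset_rfl, 1, fun _ z => z i, fun _ => ?_, ?_⟩⟩
  · fun_prop
  · ext x; simp +contextual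

theorem half_mem_ball2 : (!₂[1 / 2, 0] : CSpace 2) ∈ ball2 := by
  rw [mem_ball2]; norm_num

theorem isRamifiedCovering_squareMap :
    IsRamifiedCovering ball2 (squareMap '' ball2) {z ∈ ball2 | z 0 = 0}
      {ζ ∈ squareMap '' ball2 | ζ 0 = 0} squareMap where
  source := isBoundedDomain_ball2
  target := isBoundedDomain_image_squareMap
  analytic_source := isAnalyticSubset_sep_eq_zero isBoundedDomain_ball2.isOpen 0
  proper_source h := by
    have := (h.symm ▸ half_mem_ball2 : _ ∈ {z ∈ ball2 | z 0 = 0}).2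
    norm_num at this
  analytic_target := isAnalyticSubset_sep_eq_zero isBoundedDomain_image_squareMap.isOpen 0
  proper_target h := by
    have := (h.symm ▸ mem_image_of_mem squareMap half_mem_ball2 :
      _ ∈ {ζ ∈ squareMap '' ball2 | ζ 0 = 0}).2
    norm_num at this
  holomorphic := by
    have : Differentiable ℂ squareMap := by
      rw [differentiable_euclidean]
      intro i
      fin_cases i <;> simp <;> fun_prop
    exact this.differentiableOn
  surjOn := by
    rintro ζ ⟨⟨z, hz, rfl⟩, h⟩
    refine ⟨z, ?_, rfl⟩
    rw [← preimage_squareMap_compl]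
    exact ⟨⟨z, hz, rfl⟩, h⟩
  finite_fibers ζ _ := (finite_fiber_squareMap ζ).subset fun z hz => hz.2
  covering := by
    have hm : MapsTo squareMap (ball2 \ {z ∈ ball2 | z 0 = 0})
        (squareMap '' ball2 \ {ζ ∈ squareMap '' ball2 | ζ 0 = 0}) :=
      preimage_squareMap_compl.symm.subset
    refine ⟨hm, IsCoveringMapOn.isCoveringMap_restrict (isCoveringMapOn_squareMap.mono ?_)
      preimage_squareMap_compl hm⟩
    exact fun ζ hζ h => hζ.2 ⟨hζ.1, h⟩

/-! ### The covering group -/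

/-- The logarithm of the first coordinate straightens the set: it is the image under (u, b) ↦ (e^u,
b) of a sublevel set of the convex function e^(2 Re u) + |b|². -/
theorem isPreconnected_ball2_compl : IsPreconnected (ball2 \ {z ∈ ball2 | z 0 = 0}) := by
  have hc : Convex ℝ {p : ℂ × ℂ | Real.exp (2 * p.1.re) + ‖p.2‖ ^ 2 < 1} := by
    have h1 : ConvexOn ℝ univ fun p : ℂ × ℂ => Real.exp (2 * p.1.re) :=
      convexOn_exp.comp_linearMap
        ((2 : ℝ) • (Complex.reLm ∘ₗ LinearMap.fst ℝ ℂ ℂ))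
    have h2 : ConvexOn ℝ univ fun p : ℂ × ℂ => ‖p.2‖ ^ 2 :=
      (((convexOn_norm convex_univ).pow (fun _ _ => norm_nonneg _) 2).comp_linearMap
        (LinearMap.snd ℝ ℂ ℂ))
    simpa using (h1.add h2).convex_lt 1
  convert hc.isPreconnected.image (fun p => pairHomeo (Complex.exp p.1, p.2)) (by fun_prop) using 1
  ext z
  constructor
  · rintro ⟨hz, h0⟩
    have h0 : z 0 ≠ 0 := fun h => h0 ⟨hz, h⟩
    refine ⟨(Complex.log (z 0), z 1), ?_, cspace_two_ext (by simp [Complex.exp_log h0]) rfl⟩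
    have : Real.exp (2 * (Complex.log (z 0)).re) = ‖z 0‖ ^ 2 := by
      rw [Complex.log_re, two_mul, Real.exp_add, Real.exp_log (norm_pos_iff.mpr h0), sq]
    simpa only [mem_ofPred_eq, this] using mem_ball2.mp hz
  · rintro ⟨p, hp, rfl⟩
    refine ⟨mem_ball2.mpr ?_, fun h => Complex.exp_ne_zero p.1 h.2⟩
    simpa [Complex.norm_exp, ← Real.exp_nat_mul] using hp

theorem reflection2_mem_compl {z : CSpace 2} (hz : z ∈ ball2 \ {z ∈ ball2 | z 0 = 0}) :
    reflection2 z ∈ ball2 \ {z ∈ ball2 | z 0 = 0} := by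
  simpa [mem_ball2] using hz

/-- The restriction of the reflection to the complement of its mirror in the ball. -/
noncomputable def reflectionHomeo :
    (ball2 \ {z ∈ ball2 | z 0 = 0} : Set (CSpace 2)) ≃ₜ
      (ball2 \ {z ∈ ball2 | z 0 = 0} : Set (CSpace 2)) where
  toFun z := ⟨reflection2 z, reflection2_mem_compl z.2⟩
  invFun z := ⟨reflection2 z, reflection2_mem_compl z.2⟩
  left_inv z := Subtype.ext (reflection2.left_inv z)
  right_inv z := Subtype.ext (reflection2.left_inv z)
  continuous_toFun := by fun_prop
  continuous_invFun := by fun_prop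

theorem reflectionHomeo_mem_coveringGroup :
    reflectionHomeo ∈ coveringGroup ball2 {z ∈ ball2 | z 0 = 0} squareMap :=
  fun z => squareMap_eq_iff.mpr (.inr (reflection2.left_inv z).symm)

theorem isNormalRamifiedCovering_squareMap :
    IsNormalRamifiedCovering ball2 (squareMap '' ball2) {z ∈ ball2 | z 0 = 0}
      {ζ ∈ squareMap '' ball2 | ζ 0 = 0} squareMap where
  toIsRamifiedCovering := isRamifiedCovering_squareMap
  transitive z₁ z₂ := by
    constructor
    · intro h
      rcases squareMap_eq_iff.mp h with h | h
      · exact ⟨1, one_mem _, Subtype.ext h.symm⟩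
      · exact ⟨reflectionHomeo, reflectionHomeo_mem_coveringGroup, Subtype.ext h.symm⟩
    · rintro ⟨g, hg, rfl⟩
      exact (hg z₁).symm

/-- A deck transformation is a lift of the covering map through itself, so on a connected space its
value at one point determines it. The fibre of `z₀` has only the points `z₀` and `reflection2 z₀`.
-/
theorem coveringGroupIs_group2 :
    CoveringGroupIs ball2 {z ∈ ball2 | z 0 = 0} squareMap group2 := by
  constructor
  · intro g hg
    have : PreconnectedSpace (ball2 \ {z ∈ ball2 | z 0 = 0} : Set (CSpace 2)) :=
      isPreconnected_iff_preconnectedSpace.mp isPreconnected_ball2_compl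
    obtain ⟨hm, hcov⟩ := isRamifiedCovering_squareMap.covering
    let z₀ : (ball2 \ {z ∈ ball2 | z 0 = 0} : Set (CSpace 2)) :=
      ⟨!₂[1 / 2, 0], half_mem_ball2, fun h => by norm_num at h⟩
    rcases squareMap_eq_iff.mp (hg z₀).symm with h | h
    · refine ⟨1, one_mem _, fun z => ?_⟩
      have := hcov.eq_of_comp_eq g.continuous continuous_id
        (funext fun z => Subtype.ext (hg z)) z₀ (Subtype.ext h)
      exact congrArg Subtype.val (congrFun this z)
    · refine ⟨reflection2, .inr rfl, fun z => ?_⟩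
      have := hcov.eq_of_comp_eq g.continuous reflectionHomeo.continuous
        (funext fun z => Subtype.ext ((hg z).trans (reflectionHomeo_mem_coveringGroup z).symm)) z₀
        (Subtype.ext h)
      exact congrArg Subtype.val (congrFun this z)
  · rintro h (rfl | rfl)
    · exact ⟨1, one_mem _, fun _ => rfl⟩
    · exact ⟨reflectionHomeo, reflectionHomeo_mem_coveringGroup, fun _ => rfl⟩

section

open Metric Real

/-! ### Reproducing formulas in the disc -/

theorem integral_ball_eq_integral_circleAverage {g : ℂ → ℂ} {R : ℝ}
    (hc : ContinuousOn g (ball 0 R)) (hg : IntegrableOn g (ball 0 R)) :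
    ∫ z in ball 0 R, g z = ∫ r in Ioo 0 R, ((2 * π * r : ℝ) : ℂ) * circleAverage g 0 r := by
  classical
  have hm : Measurable ((ball (0 : ℂ) R).indicator g) := by
    rw [← piecewise_eq_indicator]
    exact hc.measurable_piecewise continuousOn_const isOpen_ball.measurableSet
  have hi : Integrable ((ball (0 : ℂ) R).indicator g) := hg.integrable_indicator measurableSet_ball
  have hp : IntegrableOn
      (fun p : ℝ × ℝ => p.1 • (ball (0 : ℂ) R).indicator g (Complex.polarCoord.symm p))
      (Ioi (0 : ℝ) ×ˢ Ioo (-π) π) := by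
    have hcont : Continuous fun p : ℝ × ℝ => Complex.polarCoord.symm p := by
      simp only [Complex.polarCoord_symm_apply]; fun_prop
    refine ⟨(measurable_fst.smul (hm.comp hcont.measurable)).aestronglyMeasurable, ?_⟩
    have h := Complex.lintegral_comp_polarCoord_symm fun z => ‖(ball (0 : ℂ) R).indicator g z‖ₑ
    rw [hasFiniteIntegral_iff_enorm]
    refine lt_of_eq_of_lt ?_ (h.trans_lt hi.hasFiniteIntegral)
    refine setLIntegral_congr_fun (measurableSet_Ioi.prod measurableSet_Ioo) fun p hp => ?_
    have : ‖p.1‖ₑ = ENNReal.ofReal p.1 := by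
      rw [← ofReal_norm, Real.norm_of_nonneg (le_of_lt hp.1)]
    simp only [enorm_smul, this, smul_eq_mul]
  rw [← integral_indicator measurableSet_ball, ← Complex.integral_comp_polarCoord_symm]
  change ∫ p in Ioi (0 : ℝ) ×ˢ Ioo (-π) π, _ = _
  rw [Measure.volume_eq_prod, setIntegral_prod _ hp]
  have hsub : Ioo 0 R ⊆ Ioi (0 : ℝ) := Ioo_subset_Ioi_self
  rw [setIntegral_eq_of_subset_of_forall_sdiff_eq_zero measurableSet_Ioi hsub]
  · refine setIntegral_congr_fun measurableSet_Ioo fun r hr => ?_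
    have h1 : ∀ θ : ℝ, r • (ball (0 : ℂ) R).indicator g (Complex.polarCoord.symm (r, θ)) =
        r • g (circleMap 0 r θ) := fun θ => by
      have h2 : Complex.polarCoord.symm (r, θ) = circleMap 0 r θ := by
        simp [Complex.polarCoord_symm_apply, circleMap, Complex.exp_mul_I]
      rw [h2, indicator_of_mem]
      simpa [abs_of_pos hr.1] using hr.2
    simp only [h1]
    rw [integral_smul, ← integral_Ioc_eq_integral_Ioo,
      ← intervalIntegral.integral_of_le (by linarith [pi_pos])]
    -- The polar chart uses angles in (-π, π), the circle average those in [0, 2π]; periodicity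
    -- identifies the two integrals.
    have hper : Function.Periodic (fun θ => g (circleMap 0 r θ)) (2 * π) := fun θ => by
      simp only [periodic_circleMap 0 r θ]
    have := hper.intervalIntegral_add_eq (-π) 0
    rw [show -π + 2 * π = π by ring, zero_add] at this
    rw [this, circleAverage]
    have hpi : (π : ℂ) ≠ 0 := by exact_mod_cast pi_ne_zero
    simp only [Complex.real_smul]
    push_cast
    field_simp
  · rintro r ⟨hr0, hr⟩
    refine setIntegral_eq_zero_of_forall_eq_zero fun θ _ => ?_
    have hr0 : 0 < r := hr0
    rw [indicator_of_notMem, smul_zero]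
    simp only [mem_ball_zero_iff, Complex.norm_polarCoord_symm, abs_of_pos hr0]
    exact fun h => hr ⟨hr0, h⟩

theorem DifferentiableOn.circleAverage_eq {f : ℂ → ℂ} {R r : ℝ}
    (hf : DifferentiableOn ℂ f (ball 0 R)) (h0 : 0 < r) (hr : r < R) : circleAverage f 0 r = f 0 := by
  refine DiffContOnCl.circleAverage (DifferentiableOn.diffContOnCl (hf.mono ?_))
  rw [abs_of_pos h0, closure_ball _ h0.ne']
  exact closedBall_subset_ball hr

theorem integral_ball_of_differentiableOn {f : ℂ → ℂ} {R : ℝ} (hR : 0 ≤ R)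
    (hf : DifferentiableOn ℂ f (ball 0 R)) (hi : IntegrableOn f (ball 0 R)) :
    ∫ z in ball 0 R, f z = ((π * R ^ 2 : ℝ) : ℂ) * f 0 := by
  rw [integral_ball_eq_integral_circleAverage hf.continuousOn hi,
    setIntegral_congr_fun (g := fun r : ℝ => ((2 * π * r : ℝ) : ℂ) * f 0) measurableSet_Ioo
      fun r hr => by rw [hf.circleAverage_eq hr.1 hr.2],
    integral_mul_const, integral_complex_ofReal, ← integral_Ioc_eq_integral_Ioo,
    ← intervalIntegral.integral_of_le hR, intervalIntegral.integral_const_mul, integral_id]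
  congr 2
  ring

/-- The derivative of G/(z - a)² has zero circle integral, which trades 2G/(z - a)³ for G'/(z - a)²;
Cauchy's formula for the derivative of G' then applies. -/
theorem circleIntegral_div_sub_pow_three {G : ℂ → ℂ} {R r : ℝ} {a : ℂ}
    (hG : DifferentiableOn ℂ G (ball 0 R)) (hr : r < R) (ha : a ∈ ball (0 : ℂ) r) :
    (∮ z in C(0, r), G z / (z - a) ^ 3) = π * Complex.I * deriv (deriv G) a := by
  have h0 : 0 ≤ r := dist_nonneg.trans (mem_ball.mp ha).le
  have hne : ∀ z ∈ sphere (0 : ℂ) r, z - a ≠ 0 := fun z hz h => by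
    rw [sub_eq_zero] at h
    subst h
    exact (mem_ball.mp ha).ne (mem_sphere.mp hz)
  have hGd : ∀ z ∈ sphere (0 : ℂ) r, DifferentiableAt ℂ G z := fun z hz =>
    hG.differentiableAt (isOpen_ball.mem_nhds (sphere_subset_ball hr hz))
  have hcG : ContinuousOn G (sphere 0 r) := hG.continuousOn.mono (sphere_subset_ball hr)
  have hdG : DifferentiableOn ℂ (deriv G) (ball 0 R) := hG.deriv isOpen_ball
  have hcdG : ContinuousOn (deriv G) (sphere 0 r) := hdG.continuousOn.mono (sphere_subset_ball hr)
  have hz := circleIntegral.integral_eq_zero_of_hasDerivWithinAt (c := 0) h0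
    (f := fun z => G z / (z - a) ^ 2)
    (f' := fun z => ((z - a) ^ 2)⁻¹ • deriv G z - 2 * (G z / (z - a) ^ 3)) fun z hz => by
      have h1 := ((hGd z hz).hasDerivAt.div (((hasDerivAt_id z).sub_const a).pow 2)
        (pow_ne_zero 2 (hne z hz)))
      refine (h1.congr_deriv ?_).hasDerivWithinAt
      have := hne z hz
      simp only [id, smul_eq_mul, Pi.pow_apply]
      field_simp
      ring
  have i1 : CircleIntegrable (fun z => ((z - a) ^ 2)⁻¹ • deriv G z) 0 r :=
    ContinuousOn.circleIntegrable h0 (((by fun_prop : ContinuousOn (fun z => (z - a) ^ 2) _).inv₀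
      fun z hz => pow_ne_zero 2 (hne z hz)).smul hcdG)
  have i2 : CircleIntegrable (fun z => 2 * (G z / (z - a) ^ 3)) 0 r :=
    ContinuousOn.circleIntegrable h0 (continuousOn_const.mul
      (hcG.div (by fun_prop) fun z hz => pow_ne_zero 3 (hne z hz)))
  rw [circleIntegral.integral_sub i1 i2, circleIntegral.integral_const_mul, sub_eq_zero] at hz
  have hC := Complex.two_pi_I_inv_smul_circleIntegral_sub_sq_inv_smul_of_differentiable
    isOpen_ball (closedBall_subset_ball hr) hdG ha
  rw [hz, smul_eq_mul] at hC
  have hpi : (π : ℂ) ≠ 0 := by exact_mod_cast pi_ne_zero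
  rw [← hC]
  field_simp

/-- On |w| = r one has w̄ = r²/w, so 1 - t w̄ = (w - t r²)/w. The cube contributes w³, the average
divides by w, and what remains is w² f(w)/(w - t r²)³ with a pole inside the circle. -/
theorem circleAverage_div_one_sub_conj_pow_three {f : ℂ → ℂ}
    (hf : DifferentiableOn ℂ f (ball 0 1)) {t r : ℝ} (ht0 : 0 ≤ t) (ht : t < 1) (hr0 : 0 < r)
    (hr : r < 1) :
    circleAverage (fun w => f w / (1 - t * conj w) ^ 3) 0 r =
      deriv (deriv fun w => w ^ 2 * f w) ((t : ℂ) * (r : ℂ) ^ 2) / 2 := by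
  have hG : DifferentiableOn ℂ (fun w => w ^ 2 * f w) (ball 0 1) := by fun_prop
  have ha : (t : ℂ) * (r : ℂ) ^ 2 ∈ ball (0 : ℂ) r := by
    rw [mem_ball_zero_iff, norm_mul, norm_pow, Complex.norm_real, Complex.norm_real,
      Real.norm_of_nonneg ht0, Real.norm_of_nonneg hr0.le]
    nlinarith
  have h := circleIntegral_div_sub_pow_three hG hr ha
  rw [circleAverage_eq_circleIntegral hr0.ne',
    circleIntegral.integral_congr (g := fun z => z ^ 2 * f z / (z - (t : ℂ) * (r : ℂ) ^ 2) ^ 3)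
      hr0.le fun z hz => ?_, h, smul_eq_mul]
  · have hpi : (π : ℂ) ≠ 0 := by exact_mod_cast pi_ne_zero
    field_simp
  · have hzr : ‖z‖ = r := by simpa using hz
    have hz0 : z ≠ 0 := norm_pos_iff.mp (hzr ▸ hr0)
    have hconj : conj z = (r : ℂ) ^ 2 / z := by
      rw [eq_div_iff hz0, mul_comm, Complex.mul_conj, Complex.normSq_eq_norm_sq, hzr]
      push_cast; rfl
    have : 1 - (t : ℂ) * conj z = (z - (t : ℂ) * (r : ℂ) ^ 2) / z := by
      rw [hconj]; field_simp
    simp only [this, div_pow, smul_eq_mul, sub_zero]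
    field_simp

theorem integral_weighted_second_deriv {f : ℂ → ℂ} (hf : DifferentiableOn ℂ f (ball 0 1)) {t : ℝ}
    (ht0 : 0 < t) (ht : t < 1) :
    ∫ r in (0 : ℝ)..1, (r : ℂ) * (1 - (r : ℂ) ^ 2) *
      deriv (deriv fun w => w ^ 2 * f w) ((t : ℂ) * (r : ℂ) ^ 2) = f t / 2 := by
  set G : ℂ → ℂ := fun w => w ^ 2 * f w with hGdef
  have hG : DifferentiableOn ℂ G (ball 0 1) := by fun_prop
  have hG' : DifferentiableOn ℂ (deriv G) (ball 0 1) := hG.deriv isOpen_ball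
  have hG'' : DifferentiableOn ℂ (deriv (deriv G)) (ball 0 1) := hG'.deriv isOpen_ball
  have htC : (t : ℂ) ≠ 0 := by exact_mod_cast ht0.ne'
  have hmem : ∀ r ∈ uIcc (0 : ℝ) 1, (t : ℂ) * (r : ℂ) ^ 2 ∈ ball (0 : ℂ) 1 := fun r hr => by
    rw [uIcc_of_le zero_le_one] at hr
    rw [mem_ball_zero_iff, norm_mul, norm_pow, Complex.norm_real, Complex.norm_real,
      Real.norm_of_nonneg ht0.le, Real.norm_of_nonneg hr.1]
    have : r ^ 2 ≤ 1 := pow_le_one₀ hr.1 hr.2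
    nlinarith
  -- The primitive comes from integrating by parts in r². At r = 1 only G(t)/(2t²) = f(t)/2
  -- survives; at r = 0 both terms vanish because G has a double zero.
  have hderiv : ∀ r ∈ uIcc (0 : ℝ) 1, HasDerivAt
      (fun r : ℝ => (1 - (r : ℂ) ^ 2) * deriv G ((t : ℂ) * (r : ℂ) ^ 2) / (2 * t) +
        G ((t : ℂ) * (r : ℂ) ^ 2) / (2 * (t : ℂ) ^ 2))
      ((r : ℂ) * (1 - (r : ℂ) ^ 2) * deriv (deriv G) ((t : ℂ) * (r : ℂ) ^ 2)) r := fun r hr => by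
    have hb := isOpen_ball.mem_nhds (hmem r hr)
    have hin : HasDerivAt (fun w : ℂ => (t : ℂ) * w ^ 2) (t * (2 * r)) (r : ℂ) := by
      simpa using (hasDerivAt_pow 2 (r : ℂ)).const_mul (t : ℂ)
    have h1 := (hG'.differentiableAt hb).hasDerivAt.comp (r : ℂ) hin
    have h2 := (hG.differentiableAt hb).hasDerivAt.comp (r : ℂ) hin
    have h3 : HasDerivAt (fun w : ℂ => 1 - w ^ 2) (-(2 * (r : ℂ))) (r : ℂ) := by
      simpa using (hasDerivAt_pow 2 (r : ℂ)).const_sub 1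
    have h4 := (((h3.mul h1).div_const (2 * (t : ℂ))).add
      (h2.div_const (2 * (t : ℂ) ^ 2))).comp_ofReal
    refine h4.congr_deriv ?_
    simp only [Function.comp]
    field_simp
    ring
  have hG0 : deriv G 0 = 0 := by
    have hf0 := (hf.differentiableAt (isOpen_ball.mem_nhds (mem_ball_self one_pos))).hasDerivAt
    exact ((hasDerivAt_pow 2 (0 : ℂ)).mul hf0).deriv.trans (by simp)
  rw [intervalIntegral.integral_eq_sub_of_hasDerivAt hderiv]
  · simp [hG0]
    simp only [hGdef]
    field_simp
    ring
  · refine ContinuousOn.intervalIntegrable (ContinuousOn.mul (by fun_prop) ?_)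
    exact hG''.continuousOn.comp (by fun_prop) hmem

/-- The reproducing formula of the disc with weight 1 - |w|², which is what remains of the ball once
its second coordinate is integrated out. -/
theorem integral_ball_weighted_div_one_sub_conj_pow_three {f : ℂ → ℂ}
    (hf : DifferentiableOn ℂ f (ball 0 1)) {t : ℝ} (ht0 : 0 ≤ t) (ht : t < 1)
    (hi : IntegrableOn (fun w => ((1 - ‖w‖ ^ 2 : ℝ) : ℂ) * (f w / (1 - t * conj w) ^ 3))
      (ball 0 1)) :
    ∫ w in ball 0 1, ((1 - ‖w‖ ^ 2 : ℝ) : ℂ) * (f w / (1 - t * conj w) ^ 3) =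
      (π / 2 : ℝ) * f t := by
  have hne : ∀ w ∈ ball (0 : ℂ) 1, (1 - (t : ℂ) * conj w) ≠ 0 := fun w hw h => by
    rw [mem_ball_zero_iff] at hw
    have h1 : ‖(t : ℂ) * conj w‖ = 1 := by rw [← sub_eq_zero.mp h, norm_one]
    rw [norm_mul, Complex.norm_real, Real.norm_of_nonneg ht0, RCLike.norm_conj] at h1
    nlinarith [norm_nonneg w]
  have hc : ContinuousOn (fun w => ((1 - ‖w‖ ^ 2 : ℝ) : ℂ) * (f w / (1 - t * conj w) ^ 3))
      (ball 0 1) := by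
    refine ContinuousOn.mul (by fun_prop) (hf.continuousOn.div ?_ fun w hw => pow_ne_zero 3 (hne w hw))
    exact (Continuous.pow (continuous_const.sub
      (continuous_const.mul Complex.continuous_conj)) 3).continuousOn
  have havg : ∀ r ∈ Ioo (0 : ℝ) 1,
      circleAverage (fun w => ((1 - ‖w‖ ^ 2 : ℝ) : ℂ) * (f w / (1 - t * conj w) ^ 3)) 0 r =
        (1 - (r : ℂ) ^ 2) * circleAverage (fun w => f w / (1 - t * conj w) ^ 3) 0 r := fun r hr => by
    rw [← smul_eq_mul (1 - (r : ℂ) ^ 2), ← circleAverage_fun_smul]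
    refine circleAverage_congr_sphere fun w hw => ?_
    have : ‖w‖ = r := by simpa [abs_of_pos hr.1] using hw
    simp [this]
  rw [integral_ball_eq_integral_circleAverage hc hi]
  -- The primitive used for t > 0 divides by t, so t = 0 is treated apart by the mean value
  -- property.
  rcases ht0.eq_or_lt with rfl | ht0
  · rw [setIntegral_congr_fun (g := fun r : ℝ => ((2 * π * (r - r ^ 3) : ℝ) : ℂ) * f 0)
      measurableSet_Ioo fun r hr => ?_, integral_mul_const, integral_complex_ofReal,
      ← integral_Ioc_eq_integral_Ioo, ← intervalIntegral.integral_of_le zero_le_one,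
      intervalIntegral.integral_const_mul, intervalIntegral.integral_sub (by simp) (by simp),
      integral_id, integral_pow]
    · norm_num
      left; ring
    · have h1 : (fun w => f w / (1 - ((0 : ℝ) : ℂ) * conj w) ^ 3) = f := by simp
      simp only [havg r hr, h1, hf.circleAverage_eq hr.1 hr.2]
      push_cast; ring
  · rw [setIntegral_congr_fun (g := fun r : ℝ => (π : ℂ) * ((r : ℂ) * (1 - (r : ℂ) ^ 2) *
        deriv (deriv fun w => w ^ 2 * f w) ((t : ℂ) * (r : ℂ) ^ 2))) measurableSet_Ioo
        fun r hr => ?_, integral_const_mul, ← integral_Ioc_eq_integral_Ioo,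
      ← intervalIntegral.integral_of_le zero_le_one, integral_weighted_second_deriv hf ht0 ht]
    · push_cast; ring
    · simp only [havg r hr, circleAverage_div_one_sub_conj_pow_three hf ht0.le ht hr.1 hr.2]
      push_cast; ring

/-! ### The Bergman kernel of the ball -/

/-- The Bergman kernel of the unit ball of `ℂ²` in closed form. -/
noncomputable def ballKernel (z w : CSpace 2) : ℂ := ((2 / π ^ 2 : ℝ) : ℂ) / (1 - inner ℂ w z) ^ 3

theorem one_sub_norm_le_norm_one_sub_inner (z : CSpace 2) {w : CSpace 2} (hw : w ∈ ball2) :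
    1 - ‖z‖ ≤ ‖1 - inner ℂ w z‖ := by
  have h1 : ‖inner ℂ w z‖ ≤ ‖w‖ * ‖z‖ := norm_inner_le_norm w z
  have h2 : ‖w‖ < 1 := mem_ball_zero_iff.mp hw
  have h3 : ‖(1 : ℂ)‖ - ‖inner ℂ w z‖ ≤ ‖1 - inner ℂ w z‖ := norm_sub_norm_le _ _
  rw [norm_one] at h3
  nlinarith [norm_nonneg z]

theorem one_sub_inner_ne_zero {z w : CSpace 2} (hz : z ∈ ball2) (hw : w ∈ ball2) :
    1 - inner ℂ w z ≠ 0 := by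
  have h := one_sub_norm_le_norm_one_sub_inner z hw
  have h2 : ‖z‖ < 1 := mem_ball_zero_iff.mp hz
  exact norm_pos_iff.mp (by linarith)

theorem ballKernel_conj (z w : CSpace 2) : conj (ballKernel z w) = ballKernel w z := by
  simp [ballKernel, Complex.conj_ofNat]

theorem norm_ballKernel (z w : CSpace 2) :
    ‖ballKernel z w‖ = 2 / π ^ 2 / ‖1 - inner ℂ w z‖ ^ 3 := by
  rw [ballKernel, norm_div, norm_pow, Complex.norm_real, Real.norm_of_nonneg (by positivity)]

theorem norm_ballKernel_le {z w : CSpace 2} (hz : z ∈ ball2) (hw : w ∈ ball2) :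
    ‖ballKernel z w‖ ≤ 2 / π ^ 2 / (1 - ‖z‖) ^ 3 := by
  have h2 : ‖z‖ < 1 := mem_ball_zero_iff.mp hz
  have : 0 < 1 - ‖z‖ := by linarith
  rw [norm_ballKernel]
  gcongr
  exact one_sub_norm_le_norm_one_sub_inner z hw

theorem measurable_ballKernel : Measurable fun p : CSpace 2 × CSpace 2 => ballKernel p.1 p.2 := by
  unfold ballKernel
  have : Continuous fun p : CSpace 2 × CSpace 2 => (1 - inner ℂ p.2 p.1) ^ 3 := by fun_prop
  exact measurable_const.div this.measurable

theorem measurableSet_ball2 : MeasurableSet ball2 := measurableSet_ball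

instance isFiniteMeasure_restrict_ball2 :
    IsFiniteMeasure (volume.restrict ball2 : Measure (CSpace 2)) :=
  ⟨by rw [Measure.restrict_apply_univ]; exact measure_ball_lt_top⟩

theorem memBergman_ballKernel {z : CSpace 2} (hz : z ∈ ball2) :
    MemBergman ball2 (fun w => conj (ballKernel z w)) where
  holomorphic := by
    simp only [ballKernel_conj]
    unfold ballKernel
    simp only [div_eq_mul_inv]
    have h : DifferentiableOn ℂ (fun w => (1 - inner ℂ z w) ^ 3) ball2 :=
      (((innerSL ℂ z).differentiable.const_sub 1).pow 3).differentiableOn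
    exact (h.inv fun w hw => pow_ne_zero 3 (one_sub_inner_ne_zero hw hz)).const_mul _
  memLp := by
    refine MemLp.of_bound (C := 2 / π ^ 2 / (1 - ‖z‖) ^ 3) ?_ ?_
    · exact (Complex.continuous_conj.measurable.comp
        (measurable_ballKernel.comp measurable_prodMk_left)).aestronglyMeasurable
    · filter_upwards [ae_restrict_mem measurableSet_ball2] with w hw
      rw [RCLike.norm_conj]
      exact norm_ballKernel_le hz hw

theorem BergmanCovering.MemBergman.integrableOn_mul {n : ℕ} {E : Set (CSpace n)} {K : CSpace n → ℂ}
    {f : CSpace n → ℂ} (hK : MemBergman E fun w => conj (K w)) (hf : MemBergman E f) :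
    IntegrableOn (fun w => K w * f w) E := by
  have : MemLp K 2 (volume.restrict E) := by
    simpa [Function.comp_def, Pi.star_def] using hK.memLp.star
  exact this.integrable_mul hf.memLp

theorem pairHomeo_mem_ball2 {a b : ℂ} : pairHomeo (a, b) ∈ ball2 ↔ ‖a‖ ^ 2 + ‖b‖ ^ 2 < 1 :=
  mem_ball2

theorem pairHomeo_mem_ball2_iff {a b : ℂ} :
    pairHomeo (a, b) ∈ ball2 ↔ b ∈ ball (0 : ℂ) √(1 - ‖a‖ ^ 2) := by
  rw [pairHomeo_mem_ball2, mem_ball_zero_iff, Real.lt_sqrt (norm_nonneg b)]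
  constructor <;> intro h <;> linarith

theorem pairHomeo_notMem_ball2 {a b : ℂ} (ha : 1 ≤ ‖a‖) : pairHomeo (a, b) ∉ ball2 := by
  rw [pairHomeo_mem_ball2]
  nlinarith [sq_nonneg ‖b‖]

theorem setIntegral_ball2_eq_integral_prod (F : CSpace 2 → ℂ) :
    ∫ w in ball2, F w = ∫ p : ℂ × ℂ, ball2.indicator F (pairHomeo p) := by
  rw [measurePreserving_pairHomeo.integral_comp pairHomeo.measurableEmbedding,
    integral_indicator measurableSet_ball2]

/-- The slice of the ball over a is a disc of radius √(1 - |a|²), on which b ↦ f(a, b) is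
holomorphic and k(a) constant. The mean value property replaces the slice integral by area times
central value. -/
theorem setIntegral_ball2_conj_mul {f : CSpace 2 → ℂ} {k : ℂ → ℂ} (hf : DifferentiableOn ℂ f ball2)
    (hi : IntegrableOn (fun w => k (w 0) * f w) ball2) :
    IntegrableOn (fun a => ((1 - ‖a‖ ^ 2 : ℝ) : ℂ) * (k a * f (pairHomeo (a, 0)))) (ball 0 1) ∧
      ∫ w in ball2, k (w 0) * f w =
        π * ∫ a in ball 0 1, ((1 - ‖a‖ ^ 2 : ℝ) : ℂ) * (k a * f (pairHomeo (a, 0))) := by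
  set F : CSpace 2 → ℂ := ball2.indicator fun w => k (w 0) * f w with hF
  have hFi : Integrable (fun p : ℂ × ℂ => F (pairHomeo p)) (volume.prod volume) :=
    (measurePreserving_pairHomeo.integrable_comp_emb pairHomeo.measurableEmbedding).mpr
      ((integrable_indicator_iff measurableSet_ball2).mpr hi)
  have hpi : (π : ℂ) ≠ 0 := by exact_mod_cast pi_ne_zero
  have hinner : ∀ᵐ a : ℂ, ∫ b, F (pairHomeo (a, b)) =
      (ball (0 : ℂ) 1).indicator
        (fun a => π * (((1 - ‖a‖ ^ 2 : ℝ) : ℂ) * (k a * f (pairHomeo (a, 0))))) a := by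
    filter_upwards [hFi.prod_right_ae] with a ha
    by_cases ha1 : a ∈ ball (0 : ℂ) 1
    · rw [indicator_of_mem ha1]
      have ha1' : ‖a‖ < 1 := mem_ball_zero_iff.mp ha1
      have hnn : 0 ≤ 1 - ‖a‖ ^ 2 := by nlinarith [norm_nonneg a]
      have h1 : (fun b => F (pairHomeo (a, b))) = (ball (0 : ℂ) √(1 - ‖a‖ ^ 2)).indicator
          fun b => k a * f (pairHomeo (a, b)) := by
        funext b
        by_cases hb : b ∈ ball (0 : ℂ) √(1 - ‖a‖ ^ 2)
        · rw [indicator_of_mem hb, hF, indicator_of_mem (pairHomeo_mem_ball2_iff.mpr hb)]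
          rfl
        · rw [indicator_of_notMem hb, hF,
            indicator_of_notMem fun h => hb (pairHomeo_mem_ball2_iff.mp h)]
      rw [h1] at ha ⊢
      rw [integrable_indicator_iff measurableSet_ball] at ha
      have hd : DifferentiableOn ℂ (fun b => k a * f (pairHomeo (a, b)))
          (ball 0 √(1 - ‖a‖ ^ 2)) := by
        refine (DifferentiableOn.comp hf ?_ fun b hb =>
          pairHomeo_mem_ball2_iff.mpr hb).const_mul (k a)
        have : Differentiable ℂ fun b => pairHomeo (a, b) := by
          rw [differentiable_euclidean]
          intro i
          fin_cases i <;> simp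
        exact this.differentiableOn
      rw [integral_indicator measurableSet_ball,
        integral_ball_of_differentiableOn (Real.sqrt_nonneg _) hd ha, Real.sq_sqrt hnn]
      push_cast
      ring
    · rw [indicator_of_notMem ha1]
      have ha1' : 1 ≤ ‖a‖ := by simpa using ha1
      simp [hF, indicator_of_notMem (pairHomeo_notMem_ball2 ha1')]
  constructor
  · have := hFi.integral_prod_left.congr hinner
    rw [integrable_indicator_iff measurableSet_ball] at this
    exact (this.const_mul (π : ℂ)⁻¹).congr (.of_forall fun a => by simp [hpi])
  · rw [setIntegral_ball2_eq_integral_prod, Measure.volume_eq_prod, integral_prod _ hFi,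
      integral_congr_ae hinner, integral_indicator measurableSet_ball, integral_const_mul]

/-- A unitary coordinate system in which `z` lies on the positive part of the first axis. -/
theorem exists_unitary_map_eq (z : CSpace 2) :
    ∃ U : UGroup 2, U z = pairHomeo (‖z‖, 0) := by
  obtain ⟨v, hv, hz⟩ : ∃ v : CSpace 2, ‖v‖ = 1 ∧ z = (‖z‖ : ℂ) • v := by
    rcases eq_or_ne z 0 with rfl | hz
    · exact ⟨EuclideanSpace.single 0 1, by simp, by simp⟩
    · have : (‖z‖ : ℂ) ≠ 0 := by exact_mod_cast norm_ne_zero_iff.mpr hz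
      exact ⟨(‖z‖ : ℂ)⁻¹ • z, by simp [norm_smul, hz], by rw [smul_inv_smul₀ this]⟩
  -- An orthonormal family indexed by {0} ⊆ `Fin 2` extends to a basis whose vector of index 0 is
  -- `v`; its coordinate map is the required unitary.
  have ho : Orthonormal ℂ (({0} : Set (Fin 2)).domRestrict fun _ => v) := by
    refine ⟨fun _ => hv, fun i j hij => ?_⟩
    exact absurd (Subsingleton.elim i j) hij
  obtain ⟨b, hb⟩ := ho.exists_orthonormalBasis_extension_of_card_eq (by simp)
  have hb0 : b 0 = v := hb 0 rfl
  refine ⟨b.repr, ?_⟩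
  rw [hz, map_smul, ← hb0, b.repr_self]
  refine cspace_two_ext ?_ ?_
  · simp [norm_smul]
  · simp

theorem LinearIsometryEquiv.measurePreserving_complex {n : ℕ} (U : UGroup n) : MeasurePreserving U :=
  LinearIsometryEquiv.measurePreserving
    { U.toLinearEquiv.restrictScalars ℝ with norm_map' := U.norm_map }

theorem LinearIsometryEquiv.map_mem_ball2 (U : UGroup 2) {z : CSpace 2} : U z ∈ ball2 ↔ z ∈ ball2 := by
  simp [ball2]

theorem LinearIsometryEquiv.preimage_ball2 (U : UGroup 2) : U ⁻¹' ball2 = ball2 := by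
  ext z; exact U.map_mem_ball2

theorem LinearIsometryEquiv.measurePreserving_restrict (U : UGroup 2) :
    MeasurePreserving U (volume.restrict ball2) (volume.restrict ball2) := by
  have := U.measurePreserving_complex.restrict_preimage measurableSet_ball2
  rwa [U.preimage_ball2] at this

theorem LinearIsometryEquiv.setIntegral_comp (U : UGroup 2) (F : CSpace 2 → ℂ) :
    ∫ w in ball2, F (U w) = ∫ w in ball2, F w :=
  U.measurePreserving_restrict.integral_comp U.toHomeomorph.measurableEmbedding F

theorem BergmanCovering.MemBergman.comp_unitary {f : CSpace 2 → ℂ} (hf : MemBergman ball2 f) (U : UGroup 2) :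
    MemBergman ball2 (f ∘ U) where
  holomorphic := hf.holomorphic.comp U.differentiable.differentiableOn
    fun _ hz => U.map_mem_ball2.mpr hz
  memLp := hf.memLp.comp_measurePreserving U.measurePreserving_restrict

/-- For z on the first axis the kernel depends on w only through its first coordinate, so the
integral reduces to the weighted formula on the disc. -/
theorem ballKernel_reproducing_axis {f : CSpace 2 → ℂ} (hf : MemBergman ball2 f) {t : ℝ}
    (ht0 : 0 ≤ t) (ht : t < 1) :
    ∫ w in ball2, ballKernel (pairHomeo (t, 0)) w * f w = f (pairHomeo (t, 0)) := by
  have hz : pairHomeo ((t : ℂ), 0) ∈ ball2 := by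
    rw [pairHomeo_mem_ball2]
    simp only [Complex.norm_real, Real.norm_of_nonneg ht0, norm_zero]
    nlinarith
  have hK : ∀ w, ballKernel (pairHomeo (t, 0)) w * f w =
      ((2 / π ^ 2 : ℝ) : ℂ) / (1 - t * conj (w 0)) ^ 3 * f w := fun w => by
    simp [ballKernel, PiLp.inner_apply, Fin.sum_univ_two]
  have hi := (memBergman_ballKernel hz).integrableOn_mul hf
  simp only [hK] at hi ⊢
  obtain ⟨h1, h2⟩ := setIntegral_ball2_conj_mul
    (k := fun a => ((2 / π ^ 2 : ℝ) : ℂ) / (1 - t * conj a) ^ 3) hf.holomorphic hi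
  have hpi : (π : ℂ) ≠ 0 := by exact_mod_cast pi_ne_zero
  have hrw : ∀ a : ℂ, ((1 - ‖a‖ ^ 2 : ℝ) : ℂ) * (f (pairHomeo (a, 0)) / (1 - t * conj a) ^ 3) =
      (π ^ 2 / 2 : ℂ) * (((1 - ‖a‖ ^ 2 : ℝ) : ℂ) *
        (((2 / π ^ 2 : ℝ) : ℂ) / (1 - t * conj a) ^ 3 * f (pairHomeo (a, 0)))) := fun a => by
    push_cast
    field_simp
  have hd : DifferentiableOn ℂ (fun a => f (pairHomeo (a, 0))) (ball 0 1) := by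
    have : Differentiable ℂ fun a => pairHomeo (a, 0) := by
      rw [differentiable_euclidean]
      intro i
      fin_cases i <;> simp
    refine DifferentiableOn.comp hf.holomorphic this.differentiableOn fun a ha => ?_
    refine pairHomeo_mem_ball2_iff.mpr (mem_ball_self ?_)
    rw [mem_ball_zero_iff] at ha
    exact Real.sqrt_pos.mpr (by nlinarith [norm_nonneg a])
  have h3 := integral_ball_weighted_div_one_sub_conj_pow_three hd ht0 ht
    (by simp only [hrw]; exact h1.const_mul _)
  simp only [hrw] at h3
  rw [integral_const_mul] at h3
  rw [h2]
  have : ∀ x y : ℂ, (π ^ 2 / 2 : ℂ) * x = ((π / 2 : ℝ) : ℂ) * y → π * x = y := fun x y h => by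
    push_cast at h
    field_simp at h
    linear_combination h
  exact this _ _ h3

theorem ballKernel_unitary (U : UGroup 2) (z w : CSpace 2) :
    ballKernel (U z) (U w) = ballKernel z w := by
  simp [ballKernel]

/-- The kernel, the ball, Lebesgue measure and the Bergman space are all unitarily invariant, so it
suffices to reproduce at points of the first axis. -/
theorem isBergmanKernel_ballKernel : IsBergmanKernel ball2 ballKernel where
  memBergman z hz := memBergman_ballKernel hz
  reproducing z hz f hf := by
    obtain ⟨U, hU⟩ := exists_unitary_map_eq z
    have h := ballKernel_reproducing_axis (hf.comp_unitary U.symm) (norm_nonneg z)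
      (mem_ball_zero_iff.mp hz)
    rw [← hU] at h
    rw [← U.setIntegral_comp] at h
    simpa [ballKernel_unitary] using h.symm

/-- Applying both reproducing formulas to the difference g of the conjugated kernels gives ∫ |g|² =
0; continuity upgrades almost everywhere to everywhere. This identifies the kernel obtained by
choice in `bergmanKernel` with the closed form. -/
theorem BergmanCovering.IsBergmanKernel.eqOn {n : ℕ} {E : Set (CSpace n)} (hE : IsOpen E)
    {K K' : CSpace n → CSpace n → ℂ} (hK : IsBergmanKernel E K) (hK' : IsBergmanKernel E K')
    {z w : CSpace n} (hz : z ∈ E) (hw : w ∈ E) : K z w = K' z w := by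
  have h1 := hK.memBergman z hz
  have h2 := hK'.memBergman z hz
  set g : CSpace n → ℂ := fun w => conj (K z w) - conj (K' z w) with hg
  have hgB : MemBergman E g := ⟨h1.holomorphic.sub h2.holomorphic, h1.memLp.sub h2.memLp⟩
  have h3 : ∫ w in E, (K z w - K' z w) * g w = 0 := by
    simp only [sub_mul]
    rw [integral_sub (h1.integrableOn_mul hgB) (h2.integrableOn_mul hgB),
      ← hK.reproducing z hz g hgB, ← hK'.reproducing z hz g hgB, sub_self]
  have h4 : ∀ w, (K z w - K' z w) * g w = ((‖g w‖ ^ 2 : ℝ) : ℂ) := fun w => by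
    have : K z w - K' z w = conj (g w) := by simp [hg]
    rw [this, mul_comm, Complex.mul_conj, Complex.normSq_eq_norm_sq]
  simp only [h4] at h3
  rw [integral_complex_ofReal, Complex.ofReal_eq_zero,
    integral_eq_zero_iff_of_nonneg (fun _ => by positivity) (hgB.memLp.integrable_norm_pow two_ne_zero)] at h3
  have h5 : g =ᵐ[volume.restrict E] fun _ => 0 := by
    filter_upwards [h3] with w hw
    simpa using hw
  have h6 := Measure.eqOn_open_of_ae_eq h5 hE hgB.holomorphic.continuousOn continuousOn_const hw
  have h7 : conj (K z w) = conj (K' z w) := sub_eq_zero.mp h6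
  exact (starRingEnd ℂ).injective h7

theorem isBergmanKernel_bergmanKernel_ball2 : IsBergmanKernel ball2 (bergmanKernel ball2) := by
  have h : ∃ K, IsBergmanKernel ball2 K := ⟨_, isBergmanKernel_ballKernel⟩
  rw [bergmanKernel, dif_pos h]
  exact h.choose_spec

theorem bergmanKernel_ball2_eq {z w : CSpace 2} (hz : z ∈ ball2) (hw : w ∈ ball2) :
    bergmanKernel ball2 z w = ballKernel z w :=
  isBergmanKernel_bergmanKernel_ball2.eqOn isBoundedDomain_ball2.isOpen
    isBergmanKernel_ballKernel hz hw

/-! ### Schur's test -/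

/-- Write k f = (k^(1/q) h)(k^(1/p) f/h) and apply Hölder in w. The first factor is handled by `hA`;
after Tonelli, `hB` handles the second. -/
theorem lintegral_rpow_le_of_schur {X : Type*} [MeasurableSpace X] {μ : Measure X} [SFinite μ]
    {k : X → X → ℝ≥0∞} (hk : Measurable (Function.uncurry k)) {h : X → ℝ≥0∞} (hh : Measurable h)
    {p q : ℝ} (hpq : p.HolderConjugate q) (h0 : ∀ᵐ x ∂μ, h x ≠ 0) (htop : ∀ᵐ x ∂μ, h x ≠ ∞)
    {A B : ℝ≥0∞} (hA : ∀ᵐ z ∂μ, ∫⁻ w, k z w * h w ^ q ∂μ ≤ A * h z ^ q)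
    (hB : ∀ᵐ w ∂μ, ∫⁻ z, k z w * h z ^ p ∂μ ≤ B * h w ^ p)
    {f : X → ℝ≥0∞} (hf : Measurable f) :
    ∫⁻ z, (∫⁻ w, k z w * f w ∂μ) ^ p ∂μ ≤ A ^ (p / q) * B * ∫⁻ w, f w ^ p ∂μ := by
  have hp : 0 < p := hpq.pos
  have hq : 0 < q := hpq.symm.pos
  have hkz : ∀ z, Measurable (k z) := fun z => hk.comp measurable_prodMk_left
  have hkw : ∀ w, Measurable fun z => k z w := fun w => hk.comp measurable_prodMk_right
  have key : ∀ᵐ z ∂μ, (∫⁻ w, k z w * f w ∂μ) ^ p ≤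
      A ^ (p / q) * ∫⁻ w, h z ^ p * (k z w * (f w / h w) ^ p) ∂μ := by
    filter_upwards [hA] with z hz
    have h1 : ∫⁻ w, k z w * f w ∂μ =
        ∫⁻ w, ((fun w => k z w ^ (1 / q) * h w) * fun w => k z w ^ (1 / p) * (f w / h w)) w ∂μ := by
      refine lintegral_congr_ae ?_
      filter_upwards [h0, htop] with w hw0 hwt
      have h2 : k z w ^ (1 / q) * k z w ^ (1 / p) = k z w := by
        rw [← ENNReal.rpow_add_of_nonneg _ _ (by positivity) (by positivity), one_div, one_div,
          add_comm, hpq.inv_add_inv_eq_one, ENNReal.rpow_one]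
      rw [Pi.mul_apply, mul_mul_mul_comm, h2, ENNReal.mul_div_cancel hw0 hwt]
    have h3 := ENNReal.lintegral_mul_le_Lp_mul_Lq μ hpq.symm
      (f := fun w => k z w ^ (1 / q) * h w) (g := fun w => k z w ^ (1 / p) * (f w / h w))
      (((hkz z).pow_const _).mul hh).aemeasurable
      (((hkz z).pow_const _).mul (hf.div hh)).aemeasurable
    have h4 : ∀ w, (k z w ^ (1 / q) * h w) ^ q = k z w * h w ^ q := fun w => by
      rw [ENNReal.mul_rpow_of_nonneg _ _ hq.le, ← ENNReal.rpow_mul, one_div_mul_cancel hq.ne',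
        ENNReal.rpow_one]
    have h5 : ∀ w, (k z w ^ (1 / p) * (f w / h w)) ^ p = k z w * (f w / h w) ^ p := fun w => by
      rw [ENNReal.mul_rpow_of_nonneg _ _ hp.le, ← ENNReal.rpow_mul, one_div_mul_cancel hp.ne',
        ENNReal.rpow_one]
    simp only [h4, h5] at h3
    rw [h1]
    calc _ ≤ ((∫⁻ w, k z w * h w ^ q ∂μ) ^ (1 / q) *
          (∫⁻ w, k z w * (f w / h w) ^ p ∂μ) ^ (1 / p)) ^ p := by gcongr
      _ = (∫⁻ w, k z w * h w ^ q ∂μ) ^ (p / q) * ∫⁻ w, k z w * (f w / h w) ^ p ∂μ := by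
          rw [ENNReal.mul_rpow_of_nonneg _ _ hp.le, ← ENNReal.rpow_mul, ← ENNReal.rpow_mul,
            one_div_mul_cancel hp.ne', ENNReal.rpow_one, one_div_mul_eq_div]
      _ ≤ (A * h z ^ q) ^ (p / q) * ∫⁻ w, k z w * (f w / h w) ^ p ∂μ := by gcongr
      _ = _ := by
          rw [ENNReal.mul_rpow_of_nonneg _ _ (by positivity), ← ENNReal.rpow_mul,
            mul_div_cancel₀ _ hq.ne', mul_assoc, lintegral_const_mul]
          exact (hkz z).mul ((hf.div hh).pow_const p)
  have hmeas : Measurable (Function.uncurry fun z w => h z ^ p * (k z w * (f w / h w) ^ p)) :=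
    ((hh.comp measurable_fst).pow_const p).mul
      (hk.mul (((hf.div hh).comp measurable_snd).pow_const p))
  calc _ ≤ ∫⁻ z, A ^ (p / q) * ∫⁻ w, h z ^ p * (k z w * (f w / h w) ^ p) ∂μ ∂μ :=
        lintegral_mono_ae key
    _ = A ^ (p / q) * ∫⁻ w, ∫⁻ z, h z ^ p * (k z w * (f w / h w) ^ p) ∂μ ∂μ := by
        rw [lintegral_const_mul _ (by exact hmeas.lintegral_prod_right'),
          lintegral_lintegral_swap hmeas.aemeasurable]
    _ ≤ A ^ (p / q) * ∫⁻ w, B * f w ^ p ∂μ := by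
        gcongr 1
        refine lintegral_mono_ae ?_
        filter_upwards [hB, h0, htop] with w hw hw0 hwt
        have h6 : ∀ z, h z ^ p * (k z w * (f w / h w) ^ p) =
            (f w / h w) ^ p * (k z w * h z ^ p) := fun z => by ring
        simp only [h6]
        rw [lintegral_const_mul _ (by exact (hkw w).mul (hh.pow_const p))]
        calc _ ≤ (f w / h w) ^ p * (B * h w ^ p) := by gcongr
          _ = B * (h w * (f w / h w)) ^ p := by
              rw [ENNReal.mul_rpow_of_nonneg _ _ hp.le]; ring
          _ = _ := by rw [ENNReal.mul_div_cancel hw0 hwt]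
    _ = _ := by rw [lintegral_const_mul _ (hf.pow_const p), mul_assoc]

/-- Reduces to a bound for nonnegative functions. The measurable kernel k' need agree with k only on
E × E, since a Bergman kernel has unspecified values elsewhere. -/
theorem isLpBoundedOperator_of_lintegral {n : ℕ} {E : Set (CSpace n)} (hE : MeasurableSet E)
    {k k' : CSpace n → CSpace n → ℝ} (hk' : Measurable (Function.uncurry k'))
    (hkk' : ∀ z ∈ E, ∀ w ∈ E, k z w = k' z w) {p : ℝ} (hp : 0 < p) {D : ℝ≥0}
    (hD : ∀ f : CSpace n → ℝ≥0∞, Measurable f →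
      ∫⁻ z in E, (∫⁻ w in E, ‖k' z w‖ₑ * f w) ^ p ≤ D * ∫⁻ w in E, f w ^ p) :
    IsLpBoundedOperator E k (ENNReal.ofReal p) := by
  have hp0 : ENNReal.ofReal p ≠ 0 := by simpa using hp
  have hpt : ENNReal.ofReal p ≠ ∞ := ENNReal.ofReal_ne_top
  have hpr : (ENNReal.ofReal p).toReal = p := ENNReal.toReal_ofReal hp.le
  refine ⟨D ^ (1 / p), fun f hf => ?_⟩
  set g := hf.1.mk f with hg
  have hgm : StronglyMeasurable g := hf.1.stronglyMeasurable_mk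
  have hfg : f =ᵐ[volume.restrict E] g := hf.1.ae_eq_mk
  have hgp : eLpNorm g (ENNReal.ofReal p) (volume.restrict E) =
      eLpNorm f (ENNReal.ofReal p) (volume.restrict E) := eLpNorm_congr_ae hfg.symm
  have hgfin : ∫⁻ w in E, ‖g w‖ₑ ^ p < ∞ := by
    have := lintegral_rpow_enorm_lt_top_of_eLpNorm_lt_top hp0 hpt (hgp.trans_lt hf.2)
    rwa [hpr] at this
  have hbound := hD (fun w => ‖g w‖ₑ) hgm.measurable.enorm
  have hkg : StronglyMeasurable fun x : CSpace n × CSpace n => ((k' x.1 x.2 : ℝ) : ℂ) * g x.2 :=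
    (((Complex.measurable_ofReal.comp hk').mul (hgm.measurable.comp measurable_snd))).stronglyMeasurable
  have henorm : ∀ z w, ‖((k' z w : ℝ) : ℂ) * g w‖ₑ = ‖k' z w‖ₑ * ‖g w‖ₑ := fun z w => by
    rw [enorm_mul]
    congr 1
    rw [← ofReal_norm, ← ofReal_norm, Complex.norm_real]
  have hcongr : ∀ z ∈ E, (fun w => (k z w : ℂ) * f w) =ᵐ[volume.restrict E]
      fun w => (k' z w : ℂ) * g w := fun z hz => by
    filter_upwards [hfg, ae_restrict_mem hE] with w hw hwE
    rw [hw, hkk' z hz w hwE]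
  have hmeasI : Measurable fun z => ∫⁻ w in E, ‖k' z w‖ₑ * ‖g w‖ₑ :=
    Measurable.lintegral_prod_right' (f := fun x : CSpace n × CSpace n => ‖k' x.1 x.2‖ₑ * ‖g x.2‖ₑ)
      (hk'.enorm.mul (hgm.measurable.comp measurable_snd).enorm)
  have hfin : ∀ᵐ z ∂(volume.restrict E), ∫⁻ w in E, ‖k' z w‖ₑ * ‖g w‖ₑ < ∞ := by
    have := ae_lt_top (hmeasI.pow_const p)
      (hbound.trans_lt (ENNReal.mul_lt_top ENNReal.coe_lt_top hgfin)).ne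
    filter_upwards [this] with z hz
    exact (ENNReal.rpow_lt_top_iff_of_pos hp).mp hz
  have hint : (fun z => ∫ w in E, (k z w : ℂ) * f w) =ᵐ[volume.restrict E]
      fun z => ∫ w in E, (k' z w : ℂ) * g w := by
    filter_upwards [ae_restrict_mem hE] with z hz
    exact integral_congr_ae (hcongr z hz)
  have hnorm : eLpNorm (fun z => ∫ w in E, (k z w : ℂ) * f w) (ENNReal.ofReal p)
      (volume.restrict E) ≤
      ((D ^ (1 / p) : ℝ≥0) : ℝ≥0∞) * eLpNorm f (ENNReal.ofReal p) (volume.restrict E) := by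
    rw [eLpNorm_congr_ae hint, ← hgp, eLpNorm_eq_lintegral_rpow_enorm_toReal hp0 hpt,
      eLpNorm_eq_lintegral_rpow_enorm_toReal hp0 hpt, hpr,
      ENNReal.coe_rpow_of_nonneg _ (by positivity),
      ← ENNReal.mul_rpow_of_nonneg _ _ (by positivity)]
    refine ENNReal.rpow_le_rpow (le_trans (lintegral_mono fun z => ?_) hbound) (by positivity)
    refine ENNReal.rpow_le_rpow ?_ hp.le
    simpa only [henorm] using enorm_integral_le_lintegral_enorm (μ := volume.restrict E)
      fun w => (k' z w : ℂ) * g w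
  refine ⟨?_, ⟨?_, ?_⟩, hnorm⟩
  · filter_upwards [hfin, ae_restrict_mem hE] with z hz hzE
    refine Integrable.congr ⟨?_, ?_⟩ (hcongr z hzE).symm
    · exact (hkg.comp_measurable measurable_prodMk_left).aestronglyMeasurable
    · rw [hasFiniteIntegral_iff_enorm]
      simpa only [henorm] using hz
  · exact hkg.integral_prod_right'.aestronglyMeasurable.congr hint.symm
  · exact hnorm.trans_lt (ENNReal.mul_lt_top ENNReal.coe_lt_top hf.2)

/-! ### Integral estimates of Forelli and Rudin -/

theorem lintegral_eq_mul_lintegral_comp_smul {R : ℝ} (hR : 0 < R) {f : ℂ → ℝ≥0∞}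
    (hf : Measurable f) : ∫⁻ x, f x = ENNReal.ofReal (R ^ 2) * ∫⁻ x, f (R • x) := by
  have h1 : ∫⁻ x, f (R • x) = ∫⁻ x, f x ∂(Measure.map (R • ·) volume) :=
    (lintegral_map hf (measurable_const_smul R)).symm
  rw [h1, Measure.map_addHaar_smul _ hR.ne', lintegral_smul_measure, Complex.finrank_real_complex,
    smul_eq_mul, ← mul_assoc, ← ENNReal.ofReal_mul (by positivity), abs_of_pos (by positivity),
    mul_inv_cancel₀ (by positivity), ENNReal.ofReal_one, one_mul]

theorem lintegral_unitDisc_one_sub_norm_sq_rpow_lt_top {α : ℝ} (hα0 : 0 < α) (hα : α < 1) :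
    ∫⁻ b in ball (0 : ℂ) 1, ENNReal.ofReal ((1 - ‖b‖ ^ 2) ^ (-α)) < ∞ := by
  have h1 : IntegrableOn (fun y : ℝ => (1 - y) ^ (-α)) (Ioo 0 1) := by
    have := (intervalIntegral.intervalIntegrable_rpow' (a := 1) (b := 0)
      (show -1 < -α by linarith)).comp_sub_left 1
    simp only [sub_self, sub_zero] at this
    rwa [intervalIntegrable_iff_integrableOn_Ioo_of_le zero_le_one] at this
  have h2 : IntegrableOn (fun y : ℝ => y ^ (Module.finrank ℝ ℂ - 1) • (1 - y ^ 2) ^ (-α))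
      (Ioo 0 1) := by
    refine Integrable.mono' h1 (Measurable.aestronglyMeasurable (by fun_prop)) ?_
    filter_upwards [ae_restrict_mem measurableSet_Ioo] with y hy
    have hy2 : 0 < 1 - y := by linarith [hy.2]
    have hy3 : 1 - y ≤ 1 - y ^ 2 := by nlinarith [hy.1]
    have h3 : (1 - y ^ 2) ^ (-α) ≤ (1 - y) ^ (-α) :=
      Real.rpow_le_rpow_of_nonpos hy2 hy3 (by linarith)
    have h4 : 0 ≤ (1 - y ^ 2) ^ (-α) := Real.rpow_nonneg (by linarith) _
    rw [Complex.finrank_real_complex, smul_eq_mul, Real.norm_of_nonneg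
      (mul_nonneg (pow_nonneg hy.1.le _) h4), pow_one]
    nlinarith [hy.1, hy.2]
  have h5 := (integrableOn_fun_norm_addHaar (volume : Measure ℂ)
    (f := fun y : ℝ => (1 - y ^ 2) ^ (-α)) (r := 1)).mpr h2
  exact (hasFiniteIntegral_iff_ofReal (by
    filter_upwards [ae_restrict_mem measurableSet_ball] with b hb
    rw [mem_ball_zero_iff] at hb
    exact Real.rpow_nonneg (by nlinarith [norm_nonneg b]) _)).mp h5.2

theorem lintegral_disc_sub_norm_sq_rpow {α ρ : ℝ} (hρ : 0 < ρ) :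
    ∫⁻ b in ball (0 : ℂ) ρ, ENNReal.ofReal ((ρ ^ 2 - ‖b‖ ^ 2) ^ (-α)) =
      ENNReal.ofReal ((ρ ^ 2) ^ (1 - α)) *
        ∫⁻ b in ball (0 : ℂ) 1, ENNReal.ofReal ((1 - ‖b‖ ^ 2) ^ (-α)) := by
  have hρ2 : 0 < ρ ^ 2 := by positivity
  rw [← lintegral_indicator measurableSet_ball, ← lintegral_indicator measurableSet_ball,
    lintegral_eq_mul_lintegral_comp_smul hρ (Measurable.indicator (by fun_prop) measurableSet_ball)]
  have h : ∀ x : ℂ, (ball (0 : ℂ) ρ).indicator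
      (fun b => ENNReal.ofReal ((ρ ^ 2 - ‖b‖ ^ 2) ^ (-α))) (ρ • x) =
      ENNReal.ofReal ((ρ ^ 2) ^ (-α)) * (ball (0 : ℂ) 1).indicator
        (fun b => ENNReal.ofReal ((1 - ‖b‖ ^ 2) ^ (-α))) x := fun x => by
    have hn : ‖ρ • x‖ = ρ * ‖x‖ := by rw [norm_smul, Real.norm_of_nonneg hρ.le]
    by_cases hx : ‖x‖ < 1
    · rw [indicator_of_mem (by rw [mem_ball_zero_iff, hn]; nlinarith),
        indicator_of_mem (mem_ball_zero_iff.mpr hx), ← ENNReal.ofReal_mul (by positivity),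
        ← Real.mul_rpow hρ2.le (by nlinarith [norm_nonneg x]), hn]
      congr 2
      ring
    · rw [indicator_of_notMem (by rw [mem_ball_zero_iff, hn]; nlinarith),
        indicator_of_notMem (by rwa [mem_ball_zero_iff]), mul_zero]
  simp only [h]
  rw [lintegral_const_mul _ (Measurable.indicator (by fun_prop) measurableSet_ball), ← mul_assoc,
    ← ENNReal.ofReal_mul hρ2.le, sub_eq_add_neg, Real.rpow_add hρ2, Real.rpow_one]

theorem lintegral_add_norm_rpow {α δ : ℝ} (hδ : 0 < δ) :
    ∫⁻ u : ℂ, ENNReal.ofReal ((δ + ‖u‖) ^ (-(2 + α))) =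
      ENNReal.ofReal (δ ^ (-α)) * ∫⁻ u : ℂ, ENNReal.ofReal ((1 + ‖u‖) ^ (-(2 + α))) := by
  rw [lintegral_eq_mul_lintegral_comp_smul hδ (by fun_prop)]
  have h : ∀ x : ℂ, ENNReal.ofReal ((δ + ‖δ • x‖) ^ (-(2 + α))) =
      ENNReal.ofReal (δ ^ (-(2 + α))) * ENNReal.ofReal ((1 + ‖x‖) ^ (-(2 + α))) := fun x => by
    rw [← ENNReal.ofReal_mul (by positivity), ← Real.mul_rpow hδ.le (by positivity), norm_smul,
      Real.norm_of_nonneg hδ.le, mul_add, mul_one]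
  simp only [h]
  rw [lintegral_const_mul _ (by fun_prop), ← mul_assoc, ← ENNReal.ofReal_mul (by positivity),
    ← Real.rpow_natCast δ 2, ← Real.rpow_add hδ]
  congr 3
  push_cast
  ring

/-- Everything is compared with N = |1 - t a|: 1 - |a|² ≤ 2N, 1 - t ≤ N and |1 - a| ≤ 2N. Hence N is
at least a third of 1 - t + |1 - a|, and 54 = 2 · 3³. -/
theorem one_sub_norm_sq_rpow_div_le {a : ℂ} (ha : ‖a‖ < 1) {t α : ℝ} (ht0 : 0 ≤ t) (ht : t < 1)
    (hα0 : 0 < α) (hα : α < 1) :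
    (1 - ‖a‖ ^ 2) ^ (1 - α) / ‖1 - t * conj a‖ ^ 3 ≤ 54 * (1 - t + ‖1 - a‖) ^ (-(2 + α)) := by
  have hN : ‖1 - (t : ℂ) * conj a‖ = ‖1 - (t : ℂ) * a‖ := by
    rw [← RCLike.norm_conj]; simp
  rw [hN]
  set N := ‖1 - (t : ℂ) * a‖
  have hta : ‖(t : ℂ) * a‖ = t * ‖a‖ := by
    rw [norm_mul, Complex.norm_real, Real.norm_of_nonneg ht0]
  have h1 : 1 - t * ‖a‖ ≤ N := by
    have := norm_sub_norm_le (1 : ℂ) ((t : ℂ) * a)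
    rwa [norm_one, hta] at this
  have h2 : ‖1 - a‖ ≤ N + (1 - t) := by
    have h3 : 1 - a = (1 - (t : ℂ) * a) - ((1 - t : ℝ) : ℂ) * a := by push_cast; ring
    rw [h3]
    refine (norm_sub_le _ _).trans ?_
    rw [norm_mul, Complex.norm_real, Real.norm_of_nonneg (by linarith)]
    have : (1 - t) * ‖a‖ ≤ 1 - t := by nlinarith
    linarith
  have h4 : 1 - t ≤ N := by nlinarith [norm_nonneg a]
  have hNpos : 0 < N := by linarith
  have h5 : (1 - t + ‖1 - a‖) / 3 ≤ N := by linarith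
  have h6 : 1 - ‖a‖ ^ 2 ≤ 2 * N := by nlinarith [norm_nonneg a]
  have h7 : (1 - ‖a‖ ^ 2) ^ (1 - α) ≤ 2 * N ^ (1 - α) := by
    calc _ ≤ (2 * N) ^ (1 - α) :=
          Real.rpow_le_rpow (by nlinarith [norm_nonneg a]) h6 (by linarith)
      _ = 2 ^ (1 - α) * N ^ (1 - α) := Real.mul_rpow (by norm_num) hNpos.le
      _ ≤ 2 * N ^ (1 - α) := by
          gcongr
          calc (2 : ℝ) ^ (1 - α) ≤ 2 ^ (1 : ℝ) :=
                Real.rpow_le_rpow_of_exponent_le (by norm_num) (by linarith)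
            _ = 2 := Real.rpow_one 2
  have hX : 0 < 1 - t + ‖1 - a‖ := by linarith [norm_nonneg (1 - a)]
  calc _ ≤ 2 * N ^ (1 - α) / N ^ 3 := by gcongr
    _ = 2 * N ^ (-(2 + α)) := by
        rw [mul_div_assoc, ← Real.rpow_natCast N 3, ← Real.rpow_sub hNpos]
        congr 2
        push_cast
        ring
    _ ≤ 2 * ((1 - t + ‖1 - a‖) / 3) ^ (-(2 + α)) := by
        gcongr 2 * ?_
        exact Real.rpow_le_rpow_of_nonpos (by positivity) h5 (by linarith)
    _ = 2 * 3 ^ (2 + α) * (1 - t + ‖1 - a‖) ^ (-(2 + α)) := by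
        rw [Real.div_rpow hX.le (by norm_num), Real.rpow_neg (by norm_num : (0 : ℝ) ≤ 3)]
        field_simp
    _ ≤ 54 * (1 - t + ‖1 - a‖) ^ (-(2 + α)) := by
        gcongr
        calc (2 : ℝ) * 3 ^ (2 + α) ≤ 2 * 3 ^ (3 : ℝ) := by
              gcongr
              · norm_num
              · linarith
          _ = 54 := by norm_num

theorem one_sub_rpow_neg_le {t α : ℝ} (ht0 : 0 ≤ t) (ht : t < 1) (hα0 : 0 < α) (hα : α < 1) :
    (1 - t) ^ (-α) ≤ 2 * (1 - t ^ 2) ^ (-α) := by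
  have h1 : 0 < 1 - t ^ 2 := by nlinarith
  calc (1 - t) ^ (-α) ≤ ((1 - t ^ 2) / 2) ^ (-α) :=
        Real.rpow_le_rpow_of_nonpos (by positivity) (by nlinarith) (by linarith)
    _ = 2 ^ α * (1 - t ^ 2) ^ (-α) := by
        rw [Real.div_rpow h1.le (by norm_num), Real.rpow_neg (by norm_num : (0 : ℝ) ≤ 2)]
        field_simp
    _ ≤ 2 * (1 - t ^ 2) ^ (-α) := by
        gcongr
        calc (2 : ℝ) ^ α ≤ 2 ^ (1 : ℝ) :=
              Real.rpow_le_rpow_of_exponent_le (by norm_num) hα.le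
          _ = 2 := Real.rpow_one 2

theorem measurable_ballWeight_div (α : ℝ) (z : CSpace 2) :
    Measurable fun w : CSpace 2 =>
      ENNReal.ofReal ((1 - ‖w‖ ^ 2) ^ (-α) / ‖1 - inner ℂ w z‖ ^ 3) := by
  have : Continuous fun w : CSpace 2 => ‖1 - inner ℂ w z‖ ^ 3 := by fun_prop
  exact (Measurable.div (by fun_prop) this.measurable).ennreal_ofReal

theorem lintegral_ballWeight_axis_le {α : ℝ} (hα0 : 0 < α) (hα : α < 1) {t : ℝ} (ht0 : 0 ≤ t)
    (ht : t < 1) :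
    ∫⁻ w in ball2, ENNReal.ofReal
        ((1 - ‖w‖ ^ 2) ^ (-α) / ‖1 - inner ℂ w (pairHomeo (t, 0))‖ ^ 3) ≤
      (∫⁻ b in ball (0 : ℂ) 1, ENNReal.ofReal ((1 - ‖b‖ ^ 2) ^ (-α))) * ENNReal.ofReal 54 *
        ((∫⁻ u : ℂ, ENNReal.ofReal ((1 + ‖u‖) ^ (-(2 + α)))) * ENNReal.ofReal 2) *
        ENNReal.ofReal ((1 - t ^ 2) ^ (-α)) := by
  set C₁ := ∫⁻ b in ball (0 : ℂ) 1, ENNReal.ofReal ((1 - ‖b‖ ^ 2) ^ (-α))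
  set C₂ := ∫⁻ u : ℂ, ENNReal.ofReal ((1 + ‖u‖) ^ (-(2 + α)))
  set F : CSpace 2 → ℝ≥0∞ := ball2.indicator fun w => ENNReal.ofReal
    ((1 - ‖w‖ ^ 2) ^ (-α) / ‖1 - inner ℂ w (pairHomeo (t, 0))‖ ^ 3) with hF
  have hFm : Measurable F := (measurable_ballWeight_div α _).indicator measurableSet_ball2
  -- The slice contributes `C₁` (1 - |a|²)^(1 - α)/|1 - t ā|³. Its bound is defined for all a, so
  -- the outer integral may run over the whole plane, where translation and scaling evaluate it.
  have hinner : ∀ a : ℂ, ∫⁻ b, F (pairHomeo (a, b)) ≤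
      C₁ * ENNReal.ofReal 54 * ENNReal.ofReal ((1 - t + ‖1 - a‖) ^ (-(2 + α))) := fun a => by
    by_cases ha : ‖a‖ < 1
    · have hpos : 0 < 1 - ‖a‖ ^ 2 := by nlinarith [norm_nonneg a]
      have hfun : (fun b => F (pairHomeo (a, b))) = fun b =>
          ENNReal.ofReal (1 / ‖1 - t * conj a‖ ^ 3) *
          (ball (0 : ℂ) √(1 - ‖a‖ ^ 2)).indicator (fun b => ENNReal.ofReal
            ((√(1 - ‖a‖ ^ 2) ^ 2 - ‖b‖ ^ 2) ^ (-α))) b := by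
        funext b
        by_cases hb : b ∈ ball (0 : ℂ) √(1 - ‖a‖ ^ 2)
        · rw [indicator_of_mem hb, hF, indicator_of_mem (pairHomeo_mem_ball2_iff.mpr hb),
            ← ENNReal.ofReal_mul (by positivity), Real.sq_sqrt hpos.le, norm_sq_cspace_two]
          congr 1
          simp only [pairHomeo_apply_zero, pairHomeo_apply_one, PiLp.inner_apply,
            Fin.sum_univ_two, RCLike.inner_apply, zero_mul, add_zero, ← sub_sub]
          ring
        · rw [indicator_of_notMem hb, hF,
            indicator_of_notMem fun h => hb (pairHomeo_mem_ball2_iff.mp h), mul_zero]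
      rw [hfun, lintegral_const_mul _ (Measurable.indicator (by fun_prop) measurableSet_ball),
        lintegral_indicator measurableSet_ball,
        lintegral_disc_sub_norm_sq_rpow (Real.sqrt_pos.mpr hpos), Real.sq_sqrt hpos.le, ← mul_assoc,
        ← ENNReal.ofReal_mul (by positivity), mul_comm, mul_assoc C₁,
        ← ENNReal.ofReal_mul (by norm_num)]
      gcongr C₁ * ENNReal.ofReal ?_
      rw [one_div_mul_eq_div]
      exact one_sub_norm_sq_rpow_div_le ha ht0 ht hα0 hα
    · have : ∀ b, F (pairHomeo (a, b)) = 0 := fun b =>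
        indicator_of_notMem (pairHomeo_notMem_ball2 (not_lt.mp ha)) _
      simp [this]
  rw [← lintegral_indicator measurableSet_ball2,
    ← measurePreserving_pairHomeo.lintegral_comp hFm, Measure.volume_eq_prod,
    lintegral_prod _ (by exact (hFm.comp pairHomeo.measurable).aemeasurable)]
  calc _ ≤ ∫⁻ a : ℂ, C₁ * ENNReal.ofReal 54 * ENNReal.ofReal ((1 - t + ‖1 - a‖) ^ (-(2 + α))) :=
        lintegral_mono hinner
    _ = C₁ * ENNReal.ofReal 54 * ∫⁻ a : ℂ, ENNReal.ofReal ((1 - t + ‖1 - a‖) ^ (-(2 + α))) :=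
        lintegral_const_mul _ (by fun_prop)
    _ = C₁ * ENNReal.ofReal 54 * (ENNReal.ofReal ((1 - t) ^ (-α)) * C₂) := by
        rw [lintegral_sub_left_eq_self
          (fun u : ℂ => ENNReal.ofReal ((1 - t + ‖u‖) ^ (-(2 + α)))) 1,
          lintegral_add_norm_rpow (by linarith)]
    _ ≤ C₁ * ENNReal.ofReal 54 * (ENNReal.ofReal (2 * (1 - t ^ 2) ^ (-α)) * C₂) := by
        gcongr
        exact one_sub_rpow_neg_le ht0 ht hα0 hα
    _ = _ := by
        rw [ENNReal.ofReal_mul (by norm_num)]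
        ring

/-- The axis estimate has a constant independent of t, and unitary invariance carries it to every z.
The constant is finite because α < 1 (integrability at the edge of the disc) and α > 0 (decay faster
than |u|⁻² at infinity). -/
theorem exists_lintegral_ballWeight_le {α : ℝ} (hα0 : 0 < α) (hα : α < 1) :
    ∃ C : ℝ≥0, ∀ z ∈ ball2, ∫⁻ w in ball2,
      ENNReal.ofReal ((1 - ‖w‖ ^ 2) ^ (-α) / ‖1 - inner ℂ w z‖ ^ 3) ≤
        C * ENNReal.ofReal ((1 - ‖z‖ ^ 2) ^ (-α)) := by
  have hfin : (∫⁻ b in ball (0 : ℂ) 1, ENNReal.ofReal ((1 - ‖b‖ ^ 2) ^ (-α))) * ENNReal.ofReal 54 *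
        ((∫⁻ u : ℂ, ENNReal.ofReal ((1 + ‖u‖) ^ (-(2 + α)))) * ENNReal.ofReal 2) ≠ ∞ := by
    refine ENNReal.mul_ne_top (ENNReal.mul_ne_top
      (lintegral_unitDisc_one_sub_norm_sq_rpow_lt_top hα0 hα).ne ENNReal.ofReal_ne_top)
      (ENNReal.mul_ne_top (finite_integral_one_add_norm ?_).ne ENNReal.ofReal_ne_top)
    rw [Complex.finrank_real_complex]
    push_cast
    linarith
  refine ⟨ENNReal.toNNReal _, fun z hz => (?_ : _ ≤ _).trans_eq
    (congrArg (· * _) (ENNReal.coe_toNNReal hfin).symm)⟩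
  obtain ⟨U, hU⟩ := exists_unitary_map_eq z
  have h := lintegral_ballWeight_axis_le hα0 hα (norm_nonneg z) (mem_ball_zero_iff.mp hz)
  rw [← hU, ← U.measurePreserving_restrict.lintegral_comp (measurable_ballWeight_div α _)] at h
  simpa only [LinearIsometryEquiv.norm_map, LinearIsometryEquiv.inner_map_map] using h

/-! ### The group generated by the reflection -/

theorem reflection2_ne_one : (1 : UGroup 2) ≠ reflection2 := by
  intro h
  have := congrArg (fun g : UGroup 2 => (g !₂[1, 0]) 0) h
  norm_num at this

theorem coe_group2 : (group2 : Set (UGroup 2)) = {1, reflection2} := rfl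

theorem card_group2 : Nat.card group2 = 2 := by
  change Nat.card (group2 : Set (UGroup 2)) = 2
  rw [coe_group2, Nat.card_coe_set_eq, ncard_pair reflection2_ne_one]

theorem jacobianDet_one {n : ℕ} : jacobianDet (1 : UGroup n) = 1 := by
  change LinearMap.det (LinearMap.id : CSpace n →ₗ[ℂ] CSpace n) = 1
  exact LinearMap.det_id

theorem jacobianDet_reflection2 : jacobianDet reflection2 = -1 := by
  rw [jacobianDet, ← LinearMap.det_toMatrix (EuclideanSpace.basisFun (Fin 2) ℂ).toBasis,
    Matrix.det_fin_two]
  simp [LinearMap.toMatrix_apply]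

theorem averagedKernel_group2 (E : Set (CSpace 2)) (z w : CSpace 2) :
    averagedKernel E group2 z w =
      2⁻¹ * (bergmanKernel E z w - bergmanKernel E z (reflection2 w)) := by
  have h : ∑ᶠ g : group2, bergmanKernel E z ((g : UGroup 2) w) *
      conj (jacobianDet (g : UGroup 2)) =
      ∑ᶠ g ∈ (group2 : Set (UGroup 2)), bergmanKernel E z (g w) * conj (jacobianDet g) :=
    finsum_set_coe_eq_finsum_mem (f := fun g : UGroup 2 =>
      bergmanKernel E z (g w) * conj (jacobianDet g)) (group2 : Set (UGroup 2))
  rw [averagedKernel, h, coe_group2, finsum_mem_pair reflection2_ne_one, card_group2,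
    jacobianDet_one, jacobianDet_reflection2]
  simp [sub_eq_add_neg]

theorem mem_fixedSubspace_reflection2 {v : CSpace 2} :
    v ∈ fixedSubspace reflection2 ↔ v 0 = 0 := by
  constructor
  · intro h
    have h' : -v 0 = v 0 := congrArg (fun x : CSpace 2 => x 0) h
    exact self_eq_neg.mp h'.symm
  · intro h
    exact cspace_two_ext (by simp [h]) rfl

theorem fixedSubspace_reflection2 :
    fixedSubspace reflection2 = Submodule.span ℂ {EuclideanSpace.single 1 1} := by
  ext v
  rw [mem_fixedSubspace_reflection2, Submodule.mem_span_singleton]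
  constructor
  · intro h
    exact ⟨v 1, cspace_two_ext (by simp [h]) (by simp)⟩
  · rintro ⟨c, rfl⟩
    simp

theorem isReflection_reflection2 : IsReflection reflection2 := by
  refine ⟨isOfFinOrder_iff_pow_eq_one.mpr ⟨2, two_pos, by rw [sq, reflection2_mul_self]⟩, ?_⟩
  rw [fixedSubspace_reflection2, finrank_span_singleton]
  simp

theorem not_isReflection_one {n : ℕ} : ¬IsReflection (1 : UGroup n) := by
  rintro ⟨-, h⟩
  have : fixedSubspace (1 : UGroup n) = ⊤ := by
    ext v
    exact ⟨fun _ => trivial, fun _ => rfl⟩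
  rw [this, finrank_top, finrank_euclideanSpace_fin] at h
  omega

theorem reflectingHyperplanes_group2 :
    reflectingHyperplanes group2 = {fixedSubspace reflection2} := by
  ext Y
  constructor
  · rintro ⟨g, rfl | rfl, hr, rfl⟩
    · exact absurd hr not_isReflection_one
    · rfl
  · rintro rfl
    exact ⟨reflection2, .inr rfl, isReflection_reflection2, rfl⟩

theorem hyperplaneOrder_group2 : hyperplaneOrder group2 (fixedSubspace reflection2) = 2 := by
  have h : {g : UGroup 2 | g ∈ group2 ∧ ∀ v ∈ fixedSubspace reflection2, g v = v} =
      {1, reflection2} := by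
    ext g
    constructor
    · exact fun h => h.1
    · rintro (rfl | rfl)
      · exact ⟨.inl rfl, fun _ _ => rfl⟩
      · exact ⟨.inr rfl, fun _ hv => hv⟩
  change Nat.card {g : UGroup 2 | g ∈ group2 ∧ ∀ v ∈ fixedSubspace reflection2, g v = v} = 2
  rw [h, Nat.card_coe_set_eq, ncard_pair reflection2_ne_one]

/-- The mirror is spanned by the second basis vector, so any root is a unimodular multiple of the
first; the exponent is 2 - 1 = 1. -/
theorem norm_jacobianPolynomial_group2 {e : Submodule ℂ (CSpace 2) → CSpace 2}
    (he : IsRootChoice group2 e) (z : CSpace 2) : ‖jacobianPolynomial group2 e z‖ = ‖z 0‖ := by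
  obtain ⟨h1, h2⟩ := he (fixedSubspace reflection2) (by rw [reflectingHyperplanes_group2]; rfl)
  have h3 := h2 (EuclideanSpace.single 1 1) (mem_fixedSubspace_reflection2.mpr (by simp))
  rw [jacobianPolynomial, reflectingHyperplanes_group2, finprod_mem_singleton,
    hyperplaneOrder_group2]
  set u := e (fixedSubspace reflection2)
  have hu1 : u 1 = 0 := by simpa [PiLp.inner_apply] using h3
  have hu0 : ‖u 0‖ = 1 := by
    have := norm_sq_cspace_two u
    rw [h1, hu1, norm_zero] at this
    rw [← sq_eq_sq₀ (norm_nonneg _) zero_le_one]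
    linarith
  simp [PiLp.inner_apply, Fin.sum_univ_two, hu1, hu0]

/-! ### The pointwise estimate of the weighted kernel -/

theorem norm_one_div_pow_three_sub_mul_le {X Y : ℂ} (hX : X ≠ 0) (hY : Y ≠ 0) :
    ‖1 / X ^ 3 - 1 / Y ^ 3‖ * ‖X + Y‖ ≤ 3 * ‖Y - X‖ * (1 / ‖X‖ ^ 3 + 1 / ‖Y‖ ^ 3) := by
  have hx : 0 < ‖X‖ := norm_pos_iff.mpr hX
  have hy : 0 < ‖Y‖ := norm_pos_iff.mpr hY
  have h1 : 1 / X ^ 3 - 1 / Y ^ 3 = (Y - X) * (Y ^ 2 + X * Y + X ^ 2) / (X ^ 3 * Y ^ 3) := by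
    field_simp
    ring
  have h2 : ‖Y ^ 2 + X * Y + X ^ 2‖ ≤ ‖Y‖ ^ 2 + ‖X‖ * ‖Y‖ + ‖X‖ ^ 2 := by
    refine (norm_add₃_le).trans_eq ?_
    simp
  have h3 : 1 / ‖X‖ ^ 3 + 1 / ‖Y‖ ^ 3 = (‖X‖ ^ 3 + ‖Y‖ ^ 3) / (‖X‖ ^ 3 * ‖Y‖ ^ 3) := by
    field_simp
    ring
  rw [h1, norm_div, norm_mul, norm_mul, norm_pow, norm_pow, h3, div_mul_eq_mul_div,
    ← mul_div_assoc]
  refine div_le_div_of_nonneg_right ?_ (by positivity)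
  calc ‖Y - X‖ * ‖Y ^ 2 + X * Y + X ^ 2‖ * ‖X + Y‖
      ≤ ‖Y - X‖ * (‖Y‖ ^ 2 + ‖X‖ * ‖Y‖ + ‖X‖ ^ 2) * (‖X‖ + ‖Y‖) := by
        gcongr
        exact norm_add_le X Y
    _ = ‖Y - X‖ * ((‖Y‖ ^ 2 + ‖X‖ * ‖Y‖ + ‖X‖ ^ 2) * (‖X‖ + ‖Y‖)) := by ring
    _ ≤ ‖Y - X‖ * (3 * (‖X‖ ^ 3 + ‖Y‖ ^ 3)) := by
        refine mul_le_mul_of_nonneg_left ?_ (norm_nonneg _)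
        -- With x = |X| and y = |Y|, the right side minus the left is 2(x + y)(x - y)².
        nlinarith [mul_nonneg (add_nonneg hx.le hy.le) (sq_nonneg (‖X‖ - ‖Y‖))]
    _ = _ := by ring

theorem rpow_le_one_add_add_inv {ρ s : ℝ} (hρ : 0 < ρ) (hs : |s| ≤ 1) :
    ρ ^ s ≤ 1 + ρ + ρ⁻¹ := by
  obtain ⟨h1, h2⟩ := abs_le.mp hs
  have hi : 0 < ρ⁻¹ := inv_pos.mpr hρ
  rcases le_total 1 ρ with h | h
  · have := Real.rpow_le_rpow_of_exponent_le h h2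
    rw [Real.rpow_one] at this
    linarith
  · have := Real.rpow_le_rpow_of_exponent_ge hρ h h1
    rw [Real.rpow_neg_one] at this
    linarith

/-- By the arithmetic–geometric inequality, 2|1 - z₂w̄₂| ≥ (1 - |z₂|²) + (1 - |w₂|²), which exceeds
|z₁|² + |w₁|². -/
theorem sq_norm_le_two_mul_norm_one_sub {z w : CSpace 2} (hz : z ∈ ball2) (hw : w ∈ ball2) :
    ‖z 0‖ ^ 2 ≤ 2 * ‖1 - conj (w 1) * z 1‖ ∧ ‖w 0‖ ^ 2 ≤ 2 * ‖1 - conj (w 1) * z 1‖ := by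
  have h1 : 1 - ‖w 1‖ * ‖z 1‖ ≤ ‖1 - conj (w 1) * z 1‖ := by
    have := norm_sub_norm_le (1 : ℂ) (conj (w 1) * z 1)
    rwa [norm_one, norm_mul, RCLike.norm_conj] at this
  rw [mem_ball2] at hz hw
  constructor <;>
    nlinarith [sq_nonneg (‖w 1‖ - ‖z 1‖), sq_nonneg ‖w 0‖, sq_nonneg ‖z 0‖, norm_nonneg (w 1),
      norm_nonneg (z 1)]

theorem inner_cspace_two (z w : CSpace 2) :
    inner ℂ w z = conj (w 0) * z 0 + conj (w 1) * z 1 := by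
  simp [PiLp.inner_apply, Fin.sum_univ_two, mul_comm]

/-- The cancellation estimate: the antisymmetric difference is of size |z₁w₁|/|1 - z₂w̄₂| relative
to the positive kernels, enough to absorb either ratio of |z₁| and |w₁|. -/
theorem weight_mul_norm_sub_le {z w : CSpace 2} (hz : z ∈ ball2) (hw : w ∈ ball2) {s : ℝ}
    (hs : |s| ≤ 1) :
    ‖z 0‖ ^ (-s) * ‖1 / (1 - inner ℂ w z) ^ 3 - 1 / (1 - inner ℂ (reflection2 w) z) ^ 3‖ *
        ‖w 0‖ ^ s ≤
      13 * (1 / ‖1 - inner ℂ w z‖ ^ 3 + 1 / ‖1 - inner ℂ (reflection2 w) z‖ ^ 3) := by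
  have hX0 := one_sub_inner_ne_zero hz hw
  have hY0 := one_sub_inner_ne_zero hz (reflection2.map_mem_ball2.mpr hw)
  have hsum : 1 - inner ℂ w z + (1 - inner ℂ (reflection2 w) z) =
      2 * (1 - conj (w 1) * z 1) := by
    simp only [inner_cspace_two, reflection2_apply_zero, reflection2_apply_one, map_neg]
    ring
  have hdiff : 1 - inner ℂ (reflection2 w) z - (1 - inner ℂ w z) = 2 * (conj (w 0) * z 0) := by
    simp only [inner_cspace_two, reflection2_apply_zero, reflection2_apply_one, map_neg]
    ring
  have hD := norm_one_div_pow_three_sub_mul_le hX0 hY0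
  have htri := norm_sub_le (1 / (1 - inner ℂ w z) ^ 3) (1 / (1 - inner ℂ (reflection2 w) z) ^ 3)
  simp only [norm_div, norm_one, norm_pow] at htri
  rw [hsum, hdiff, norm_mul, norm_mul, norm_mul, RCLike.norm_conj, Complex.norm_ofNat] at hD
  obtain ⟨hza, hwa⟩ := sq_norm_le_two_mul_norm_one_sub hz hw
  have hS : 0 ≤ 1 / ‖1 - inner ℂ w z‖ ^ 3 + 1 / ‖1 - inner ℂ (reflection2 w) z‖ ^ 3 := by positivity
  -- If z or w lies on the mirror, X = Y and the difference vanishes, whatever value the power of 0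
  -- takes.
  rcases eq_or_ne (conj (w 0) * z 0) 0 with h0 | h0
  · rw [h0, mul_zero, sub_eq_zero] at hdiff
    rw [hdiff, sub_self, norm_zero, mul_zero, zero_mul]
    positivity
  have hz0 : 0 < ‖z 0‖ := norm_pos_iff.mpr (right_ne_zero_of_mul h0)
  have hw0 : 0 < ‖w 0‖ := norm_pos_iff.mpr fun h => h0 (by simp [h])
  have hDnn := norm_nonneg
    (1 / (1 - inner ℂ w z) ^ 3 - 1 / (1 - inner ℂ (reflection2 w) z) ^ 3)
  generalize ‖1 / (1 - inner ℂ w z) ^ 3 - 1 / (1 - inner ℂ (reflection2 w) z) ^ 3‖ = D at *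
  generalize 1 / ‖1 - inner ℂ w z‖ ^ 3 + 1 / ‖1 - inner ℂ (reflection2 w) z‖ ^ 3 = S at *
  generalize ‖1 - conj (w 1) * z 1‖ = a at *
  generalize ‖z 0‖ = x at *
  generalize ‖w 0‖ = y at *
  have hapos : 0 < a := by nlinarith
  have hρ : 0 < y / x := div_pos hw0 hz0
  have h1 : D * (y / x) ≤ 6 * S := by
    rw [mul_div_assoc', div_le_iff₀ hz0]
    refine le_of_mul_le_mul_right ?_ hapos
    nlinarith [mul_le_mul_of_nonneg_left hwa (mul_nonneg hz0.le hS),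
      mul_le_mul_of_nonneg_left hD hw0.le]
  have h2 : D * (y / x)⁻¹ ≤ 6 * S := by
    rw [inv_div, mul_div_assoc', div_le_iff₀ hw0]
    refine le_of_mul_le_mul_right ?_ hapos
    nlinarith [mul_le_mul_of_nonneg_left hza (mul_nonneg hw0.le hS),
      mul_le_mul_of_nonneg_left hD hz0.le]
  calc x ^ (-s) * D * y ^ s = D * (y / x) ^ s := by
        rw [Real.div_rpow hw0.le hz0.le, Real.rpow_neg hz0.le]
        ring
    _ ≤ D * (1 + y / x + (y / x)⁻¹) := by
        gcongr
        exact rpow_le_one_add_add_inv hρ hs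
    -- 13 = 1 + 6 + 6: the triangle inequality `htri` for the term 1, and `h1`, `h2` for the two
    -- ratios.
    _ ≤ 13 * S := by linarith

/-! ### Boundedness of the operator -/

/-- The positive kernel dominating the weighted kernels. -/
noncomputable def majorantKernel (z w : CSpace 2) : ℝ≥0∞ :=
  ENNReal.ofReal (1 / ‖1 - inner ℂ w z‖ ^ 3) +
    ENNReal.ofReal (1 / ‖1 - inner ℂ (reflection2 w) z‖ ^ 3)

theorem measurable_majorantKernel : Measurable (Function.uncurry majorantKernel) := by
  have h1 : Continuous fun p : CSpace 2 × CSpace 2 => ‖1 - inner ℂ p.2 p.1‖ ^ 3 := by fun_prop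
  have h2 : Continuous fun p : CSpace 2 × CSpace 2 => ‖1 - inner ℂ (reflection2 p.2) p.1‖ ^ 3 := by
    fun_prop
  exact (measurable_const.div h1.measurable).ennreal_ofReal.add
    (measurable_const.div h2.measurable).ennreal_ofReal

theorem inner_reflection2_left (z w : CSpace 2) :
    inner ℂ (reflection2 w) z = inner ℂ w (reflection2 z) := by
  simp [inner_cspace_two]

/-- The reflection is self-adjoint. Symmetry lets one estimate serve both hypotheses of Schur's
test. -/
theorem majorantKernel_comm (z w : CSpace 2) : majorantKernel z w = majorantKernel w z := by
  have h : ∀ x y : CSpace 2, ‖1 - inner ℂ x y‖ = ‖1 - inner ℂ y x‖ := fun x y => by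
    rw [← RCLike.norm_conj, map_sub, map_one, inner_conj_symm]
  rw [majorantKernel, majorantKernel, h w z, h (reflection2 w) z, inner_reflection2_left]

theorem exists_lintegral_majorantKernel_le {α : ℝ} (hα0 : 0 < α) (hα : α < 1) :
    ∃ C : ℝ≥0, ∀ z ∈ ball2, ∫⁻ w in ball2,
      majorantKernel z w * ENNReal.ofReal ((1 - ‖w‖ ^ 2) ^ (-α)) ≤
        C * ENNReal.ofReal ((1 - ‖z‖ ^ 2) ^ (-α)) := by
  obtain ⟨C, hC⟩ := exists_lintegral_ballWeight_le hα0 hα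
  refine ⟨C + C, fun z hz => ?_⟩
  have h1 : ∀ w, majorantKernel z w * ENNReal.ofReal ((1 - ‖w‖ ^ 2) ^ (-α)) =
      ENNReal.ofReal ((1 - ‖w‖ ^ 2) ^ (-α) / ‖1 - inner ℂ w z‖ ^ 3) +
      ENNReal.ofReal ((1 - ‖reflection2 w‖ ^ 2) ^ (-α) / ‖1 - inner ℂ (reflection2 w) z‖ ^ 3) := by
    intro w
    rw [majorantKernel, add_mul, ← ENNReal.ofReal_mul (by positivity),
      ← ENNReal.ofReal_mul (by positivity), one_div_mul_eq_div, one_div_mul_eq_div,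
      LinearIsometryEquiv.norm_map]
  simp only [h1]
  rw [lintegral_add_left (measurable_ballWeight_div α z), reflection2.measurePreserving_restrict.lintegral_comp
    (measurable_ballWeight_div α z), ENNReal.coe_add, add_mul]
  exact add_le_add (hC z hz) (hC z hz)

theorem lintegral_majorantKernel_rpow_le {p : ℝ} (hp : 1 < p) :
    ∃ D : ℝ≥0, ∀ f : CSpace 2 → ℝ≥0∞, Measurable f →
      ∫⁻ z in ball2, (∫⁻ w in ball2, majorantKernel z w * f w) ^ p ≤
        D * ∫⁻ w in ball2, f w ^ p := by
  obtain ⟨q, hpq⟩ : ∃ q, p.HolderConjugate q := ⟨_, Real.HolderConjugate.conjExponent hp⟩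
  have hq : 1 < q := hpq.symm.lt
  have hp0 : 0 < p := hpq.pos
  have hq0 : 0 < q := hpq.symm.pos
  obtain ⟨A, hA⟩ := exists_lintegral_majorantKernel_le (α := 1 / p) (by positivity)
    ((div_lt_one hp0).mpr hp)
  obtain ⟨B, hB⟩ := exists_lintegral_majorantKernel_le (α := 1 / q) (by positivity)
    ((div_lt_one hq0).mpr hq)
  -- The exponent makes h^q and h^p the powers -1/p and -1/q of 1 - |z|², both within the range -1 <
  -- -α < 0 of the Forelli–Rudin estimate.
  set h : CSpace 2 → ℝ≥0∞ := fun z => ENNReal.ofReal ((1 - ‖z‖ ^ 2) ^ (-(1 / (p * q)))) with hh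
  have hpos : ∀ z ∈ ball2, 0 < 1 - ‖z‖ ^ 2 := fun z hz => by
    have := mem_ball_zero_iff.mp hz
    nlinarith [norm_nonneg z]
  have hpow : ∀ z ∈ ball2, ∀ r : ℝ, 0 ≤ r →
      h z ^ r = ENNReal.ofReal ((1 - ‖z‖ ^ 2) ^ (-(1 / (p * q)) * r)) := fun z hz r hr => by
    rw [hh, ENNReal.ofReal_rpow_of_nonneg (Real.rpow_nonneg (hpos z hz).le _) hr,
      ← Real.rpow_mul (hpos z hz).le]
  have hhq : ∀ z ∈ ball2, h z ^ q = ENNReal.ofReal ((1 - ‖z‖ ^ 2) ^ (-(1 / p))) := fun z hz => by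
    rw [hpow z hz q hq0.le]
    congr 2
    field_simp
  have hhp : ∀ z ∈ ball2, h z ^ p = ENNReal.ofReal ((1 - ‖z‖ ^ 2) ^ (-(1 / q))) := fun z hz => by
    rw [hpow z hz p hp0.le]
    congr 2
    field_simp
  refine ⟨A ^ (p / q) * B, fun f hf => ?_⟩
  have hS := lintegral_rpow_le_of_schur (μ := volume.restrict ball2) measurable_majorantKernel
    (h := h) (by fun_prop) hpq ?_ ?_ (A := A) (B := B) ?_ ?_ hf
  · rwa [ENNReal.coe_mul, ENNReal.coe_rpow_of_nonneg _ (by positivity)]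
  · filter_upwards [ae_restrict_mem measurableSet_ball2] with z hz
    simpa [hh] using Real.rpow_pos_of_pos (hpos z hz) _
  · exact .of_forall fun z => ENNReal.ofReal_ne_top
  · filter_upwards [ae_restrict_mem measurableSet_ball2] with z hz
    rw [hhq z hz, setLIntegral_congr_fun measurableSet_ball2 fun w hw => by rw [hhq w hw]]
    exact hA z hz
  · filter_upwards [ae_restrict_mem measurableSet_ball2] with w hw
    rw [hhp w hw, setLIntegral_congr_fun measurableSet_ball2 fun z hz => by
      rw [hhp z hz, majorantKernel_comm]]
    exact hB w hw

/-- The constant is 1/|G| = 1/2 times the 2/π² of the Bergman kernel. -/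
theorem norm_weightedKernel_group2 {e : Submodule ℂ (CSpace 2) → CSpace 2}
    (he : IsRootChoice group2 e) (p : ℝ) {z w : CSpace 2} (hz : z ∈ ball2) (hw : w ∈ ball2) :
    ‖weightedKernel ball2 group2 e p z w‖ = (π ^ 2)⁻¹ * (‖z 0‖ ^ (-(1 - 2 / p)) *
      ‖1 / (1 - inner ℂ w z) ^ 3 - 1 / (1 - inner ℂ (reflection2 w) z) ^ 3‖ *
        ‖w 0‖ ^ (1 - 2 / p)) := by
  have h1 : averagedKernel ball2 group2 z w = ((π ^ 2)⁻¹ : ℝ) *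
      (1 / (1 - inner ℂ w z) ^ 3 - 1 / (1 - inner ℂ (reflection2 w) z) ^ 3) := by
    rw [averagedKernel_group2, bergmanKernel_ball2_eq hz hw,
      bergmanKernel_ball2_eq hz (reflection2.map_mem_ball2.mpr hw), ballKernel, ballKernel]
    push_cast
    ring
  rw [weightedKernel, h1, norm_mul, norm_mul, norm_mul, Complex.norm_real, Complex.norm_real,
    Complex.norm_real, norm_jacobianPolynomial_group2 he, norm_jacobianPolynomial_group2 he,
    Real.norm_of_nonneg (by positivity), Real.norm_of_nonneg (by positivity),
    Real.norm_of_nonneg (by positivity), neg_sub]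
  ring

theorem isLpBoundedOperator_weightedKernel {e : Submodule ℂ (CSpace 2) → CSpace 2}
    (he : IsRootChoice group2 e) {p : ℝ} (hp : 1 < p) :
    IsLpBoundedOperator ball2 (fun z w => ‖weightedKernel ball2 group2 e p z w‖)
      (ENNReal.ofReal p) := by
  have hp0 : 0 < p := by linarith
  -- This is where the range of p enters the pointwise estimate: 0 < 2/p ≤ 2.
  have hs : |1 - 2 / p| ≤ 1 := by
    have h1 : 0 < 2 / p := by positivity
    have h2 : 2 / p ≤ 2 := by rw [div_le_iff₀ hp0]; linarith
    rw [abs_le]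
    constructor <;> linarith
  obtain ⟨D, hD⟩ := lintegral_majorantKernel_rpow_le hp
  have hmeas : Measurable (Function.uncurry fun z w : CSpace 2 =>
      (π ^ 2)⁻¹ * (‖z 0‖ ^ (-(1 - 2 / p)) *
        ‖1 / (1 - inner ℂ w z) ^ 3 - 1 / (1 - inner ℂ (reflection2 w) z) ^ 3‖ *
          ‖w 0‖ ^ (1 - 2 / p))) := by
    have h1 : Continuous fun x : CSpace 2 × CSpace 2 => (1 - inner ℂ x.2 x.1) ^ 3 := by fun_prop
    have h2 : Continuous fun x : CSpace 2 × CSpace 2 =>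
        (1 - inner ℂ (reflection2 x.2) x.1) ^ 3 := by fun_prop
    have h3 : Continuous fun x : CSpace 2 × CSpace 2 => ‖x.1 0‖ := by fun_prop
    have h4 : Continuous fun x : CSpace 2 × CSpace 2 => ‖x.2 0‖ := by fun_prop
    exact (((h3.measurable.pow_const _).mul ((measurable_const.div h1.measurable).sub
      (measurable_const.div h2.measurable)).norm).mul (h4.measurable.pow_const _)).const_mul _
  refine isLpBoundedOperator_of_lintegral measurableSet_ball2 hmeas
    (fun z hz w hw => norm_weightedKernel_group2 he p hz hw) hp0 (D := 13 ^ p * D) fun f hf => ?_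
  have hle : ∀ z ∈ ball2, ∀ w ∈ ball2, ‖(π ^ 2)⁻¹ * (‖z 0‖ ^ (-(1 - 2 / p)) *
      ‖1 / (1 - inner ℂ w z) ^ 3 - 1 / (1 - inner ℂ (reflection2 w) z) ^ 3‖ *
        ‖w 0‖ ^ (1 - 2 / p))‖ₑ ≤ 13 * majorantKernel z w := fun z hz w hw => by
    rw [← ofReal_norm, Real.norm_of_nonneg (by positivity), majorantKernel,
      ← ENNReal.ofReal_add (by positivity) (by positivity),
      show (13 : ℝ≥0∞) = ENNReal.ofReal 13 by simp, ← ENNReal.ofReal_mul (by norm_num)]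
    refine ENNReal.ofReal_le_ofReal (le_trans ?_ (weight_mul_norm_sub_le hz hw hs))
    -- The factor π⁻² is at most 1 and is discarded.
    refine mul_le_of_le_one_left (by positivity) (inv_le_one_of_one_le₀ ?_)
    nlinarith [pi_gt_three]
  have hmz : ∀ z, Measurable fun w => majorantKernel z w * f w := fun z =>
    (measurable_majorantKernel.comp measurable_prodMk_left).mul hf
  have hmI : Measurable fun z => ∫⁻ w in ball2, majorantKernel z w * f w :=
    Measurable.lintegral_prod_right' (f := fun x : CSpace 2 × CSpace 2 =>
      majorantKernel x.1 x.2 * f x.2) (measurable_majorantKernel.mul (hf.comp measurable_snd))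
  calc _ ≤ ∫⁻ z in ball2, (13 * ∫⁻ w in ball2, majorantKernel z w * f w) ^ p := by
        refine setLIntegral_mono' measurableSet_ball2 fun z hz => ?_
        refine ENNReal.rpow_le_rpow ?_ hp0.le
        rw [← lintegral_const_mul _ (hmz z)]
        refine setLIntegral_mono' measurableSet_ball2 fun w hw => ?_
        exact (mul_le_mul_left (hle z hz w hw) (f w)).trans_eq (mul_assoc _ _ _)
    _ = 13 ^ p * ∫⁻ z in ball2, (∫⁻ w in ball2, majorantKernel z w * f w) ^ p := by
        simp only [ENNReal.mul_rpow_of_nonneg _ _ hp0.le]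
        exact lintegral_const_mul _ (hmI.pow_const p)
    _ ≤ 13 ^ p * (D * ∫⁻ w in ball2, f w ^ p) := by
        gcongr
        exact hD f hf
    _ = _ := by
        rw [ENNReal.coe_mul, ENNReal.coe_rpow_of_nonneg _ hp0.le, mul_assoc]
        rfl

end

theorem theoremA1 :
    -- `π` is a normal ramified covering of `π(B₂)` by `B₂`, with covering group `G = {id, r}`
    (IsNormalRamifiedCovering ball2 (squareMap '' ball2) {z ∈ ball2 | z 0 = 0}
        {ζ ∈ squareMap '' ball2 | ζ 0 = 0} squareMap ∧
      CoveringGroupIs ball2 {z ∈ ball2 | z 0 = 0} squareMap group2) ∧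
    -- the Bergman kernel of `B₂` exists
    IsBergmanKernel ball2 (bergmanKernel ball2) ∧
    -- boundedness of the operator with kernel `|K_{G,p}|`, for every choice of roots
    ∀ e : Submodule ℂ (CSpace 2) → CSpace 2, IsRootChoice group2 e →
      ∀ p : ℝ, 1 < p →
        IsLpBoundedOperator ball2 (fun z w => ‖weightedKernel ball2 group2 e p z w‖)
          (ENNReal.ofReal p) := by
  exact ⟨⟨isNormalRamifiedCovering_squareMap, coveringGroupIs_group2⟩,
    isBergmanKernel_bergmanKernel_ball2, fun e he p hp => isLpBoundedOperator_weightedKernel he hp⟩
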